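/- Let $\mathfrak{L}$ be a finite-dimensional complex Lie algebra with a fixed Levi decomposition $\mathfrak{L}=\mathfrak{g}\ltimes\mathfrak{r}$, where $\mathfrak{g}$ is a semisimple subalgebra and $\mathfrak{r}$ is the radical of $\mathfrak{L}$, and assume that $\mathfrak{r}$ is abelian (a generalized Takiff algebra). Let $\overline{Z(\mathfrak{L})}:=Z(\mathfrak{L})\cap U(\mathfrak{r})$ be the purely radical part of the center $Z(\mathfrak{L})$ of the universal enveloping algebra $U(\mathfrak{L})$. A radical central character is an algebra homomorphism $\chi\colon\overline{Z(\mathfrak{L})}\to\mathbb{C}$; an $\mathfrak{L}$-module has radical central character $\chi$ if every $z\in\overline{Z(\mathfrak{L})}$ acts on it as the scalar $\chi(z)$. A simple $\mathfrak{g}$-module is a $\mathfrak{g}$-type of an $\mathfrak{L}$-module if it is isomorphic to one of its $\mathfrak{g}$-submodules. An $\mathfrak{L}$-module is $\mathfrak{g}$-Harish-Chandra if, as a $\mathfrak{g}$-module, it is a direct sum of simple finite-dimensional $\mathfrak{g}$-modules in which each isomorphism class occurs with finite multiplicity. Let $Q(0):=U(\mathfrak{L})\otimes_{U(\mathfrak{g})}\mathbb{C}$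 be the module induced from the trivial $\mathfrak{g}$-module, and put $Q(0,\chi):=Q(0)/\mathbf{m}_\chi Q(0)$ with $\mathbf{m}_\chi:=\ker\chi$. Fix a radical central character $\chi$. Then $Q(0,\chi)$ has a unique simple quotient $V(0,\chi)$, namely its quotient by the sum of all its proper submodules, and the following hold. 1. $V(0,\chi)$ is, up to isomorphism, the unique simple $\mathfrak{L}$-module having both radical central character $\chi$ and the trivial $\mathfrak{g}$-module as one of its $\mathfrak{g}$-types. 2. If $[\mathfrak{g},\mathfrak{r}]=\mathfrak{r}$, then $V(0,\chi)$ is either the trivial one-dimensional $\mathfrak{L}$-module or infinite-dimensional, and it is the trivial $\mathfrak{L}$-module precisely when $\chi$ is the radical central character of the trivial $\mathfrak{L}$-module. 3. $V(0,\chi)$ is a $\mathfrak{g}$-Harish-Chandra module. -/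

import Mathlib

open scoped TensorProduct

noncomputable section

namespace GenTakiff

universe u v w

attribute [local instance 100] LieRing.ofAssociativeRing

section General

variable (L : Type u) [LieRing L] [LieAlgebra ℂ L]

/-- The universal enveloping algebra `U(L)` over `ℂ`. -/
abbrev U : Type u := UniversalEnvelopingAlgebra ℂ L

/-- The action of `U(L)` on an `L`-module `W`, extending the action of `L`. -/
def uAct (W : Type w) [AddCommGroup W] [Module ℂ W] [LieRingModule L W] [LieModule ℂ L W] :
    U L →ₐ[ℂ] Module.End ℂ W :=
  UniversalEnvelopingAlgebra.lift ℂ (LieModule.toEnd ℂ L W)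

/-- The algebra homomorphism `U(r) → U(L)` induced by the inclusion of the radical
`r` of `L`. -/
def uRadIncl : U (LieAlgebra.radical ℂ L) →ₐ[ℂ] U L :=
  UniversalEnvelopingAlgebra.lift ℂ
    ((UniversalEnvelopingAlgebra.ι ℂ (L := L)).comp (LieAlgebra.radical ℂ L).incl)

/-- The purely radical part `Z(L) ∩ U(r)` of the center `Z(L)` of `U(L)`, where `r` is the
radical of `L`. -/
def radCenter : Subalgebra ℂ (U L) :=
  Subalgebra.center ℂ (U L) ⊓ (uRadIncl L).range

/-- A radical central character: an algebra homomorphism `Z(L) ∩ U(r) → ℂ`. -/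
abbrev RadCentralChar : Type u := radCenter L →ₐ[ℂ] ℂ

variable {L} in
/-- The `L`-module `W` has radical central character `χ`: every `z ∈ Z(L) ∩ U(r)` acts on `W` as
the scalar `χ z`. -/
def HasRadCentralChar (χ : RadCentralChar L)
    (W : Type w) [AddCommGroup W] [Module ℂ W] [LieRingModule L W] [LieModule ℂ L W] : Prop :=
  ∀ (z : radCenter L) (x : W), uAct L W (z : U L) x = χ z • x

/-- The trivial one-dimensional module. -/
abbrev Triv : Type := TrivialLieModule ℂ L ℂ

end General

variable {L : Type u} [LieRing L] [LieAlgebra ℂ L] (g : LieSubalgebra ℂ L)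

section Restriction

variable (W : Type w) [AddCommGroup W] [Module ℂ W] [LieRingModule L W] [LieModule ℂ L W]

/-- The simple `g`-module `S` is a `g`-type of the `L`-module `W`: some `g`-submodule of `W` is
isomorphic to `S`. -/
def HasType (S : Type v) [AddCommGroup S] [Module ℂ S] [LieRingModule g S] : Prop :=
  ∃ N : LieSubmodule ℂ g W, Nonempty (S ≃ₗ⁅ℂ, g⁆ N)

/-- The `L`-module `W` is a `g`-Harish-Chandra module: as a `g`-module, it is the internal direct
sum of a family of simple finite-dimensional `g`-submodules, in which each isomorphism class occurs
only finitely many times. -/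
def IsHarishChandra : Prop :=
  ∃ S : Set (LieSubmodule ℂ g W),
    (∀ N ∈ S, LieModule.IsIrreducible ℂ g N ∧ FiniteDimensional ℂ N) ∧
    sSupIndep S ∧ sSup S = ⊤ ∧
    ∀ N ∈ S, {N' ∈ S | Nonempty (N' ≃ₗ⁅ℂ, g⁆ N)}.Finite

end Restriction

section Induction

/-- The algebra homomorphism `U(g) → U(L)` induced by the inclusion of the subalgebra `g`. -/
def uIncl : U g →ₐ[ℂ] U L :=
  UniversalEnvelopingAlgebra.lift ℂ ((UniversalEnvelopingAlgebra.ι ℂ (L := L)).comp g.incl)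

variable (M : Type v) [AddCommGroup M] [Module ℂ M] [LieRingModule g M] [LieModule ℂ g M]

/-- The relations `u a ⊗ m = u ⊗ a m`, for `u ∈ U(L)` and `a ∈ U(g)`, by which `U(L) ⊗_ℂ M` is to
be divided to give `U(L) ⊗_{U(g)} M`. -/
def indRel : Submodule (U L) (U L ⊗[ℂ] M) :=
  Submodule.span (U L)
    {t | ∃ (b : U L) (a : U g) (m : M), t = (b * uIncl g a) ⊗ₜ[ℂ] m - b ⊗ₜ[ℂ] (uAct g M a m)}

/-- The induced module `Ind_g^L M = U(L) ⊗_{U(g)} M`. -/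
def Ind : Type (max u v) := (U L ⊗[ℂ] M) ⧸ indRel g M

instance : AddCommGroup (Ind g M) := inferInstanceAs (AddCommGroup ((U L ⊗[ℂ] M) ⧸ indRel g M))

instance : Module (U L) (Ind g M) := inferInstanceAs (Module (U L) ((U L ⊗[ℂ] M) ⧸ indRel g M))

instance : Module ℂ (Ind g M) := inferInstanceAs (Module ℂ ((U L ⊗[ℂ] M) ⧸ indRel g M))

instance : IsScalarTower ℂ (U L) (Ind g M) :=
  inferInstanceAs (IsScalarTower ℂ (U L) ((U L ⊗[ℂ] M) ⧸ indRel g M))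

/-- `L` acts on `U(L) ⊗_{U(g)} M` by left multiplication on the first factor. -/
instance : LieRingModule L (Ind g M) where
  bracket x m := UniversalEnvelopingAlgebra.ι ℂ x • m
  add_lie x y m := by
    change UniversalEnvelopingAlgebra.ι ℂ (x + y) • m = _
    rw [map_add, add_smul]
  lie_add x m n := smul_add _ m n
  leibniz_lie x y m := by
    change UniversalEnvelopingAlgebra.ι ℂ x • UniversalEnvelopingAlgebra.ι ℂ y • m =
      UniversalEnvelopingAlgebra.ι ℂ ⁅x, y⁆ • m +
        UniversalEnvelopingAlgebra.ι ℂ y • UniversalEnvelopingAlgebra.ι ℂ x • m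
    rw [LieHom.map_lie, LieRing.of_associative_ring_bracket, sub_smul, mul_smul, mul_smul,
      sub_add_cancel]

instance : LieModule ℂ L (Ind g M) where
  smul_lie t x m := by
    change UniversalEnvelopingAlgebra.ι ℂ (t • x) • m = t • (UniversalEnvelopingAlgebra.ι ℂ x • m)
    rw [map_smul, smul_assoc]
  lie_smul t x m := by
    change UniversalEnvelopingAlgebra.ι ℂ x • (t • m) = t • (UniversalEnvelopingAlgebra.ι ℂ x • m)
    exact smul_algebra_smul_comm t (UniversalEnvelopingAlgebra.ι ℂ x) m

end Induction

/-- The universal module `Q(0) = U(L) ⊗_{U(g)} L(0)`, where `L(0)` is the trivial `g`-module. -/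
abbrev Q0 : Type u := Ind g (Triv g)

/-- The submodule `m_χ Q(0)` of `Q(0)`, where `m_χ` is the kernel of `χ`. -/
def mQ (χ : RadCentralChar L) : LieSubmodule ℂ L (Q0 g) :=
  LieSubmodule.lieSpan ℂ L
    {q | ∃ (z : radCenter L) (p : Q0 g), χ z = 0 ∧ q = uAct L (Q0 g) (z : U L) p}

/-- The universal module `Q(0, χ) = Q(0) / m_χ Q(0)`. -/
abbrev Q (χ : RadCentralChar L) : Type u := Q0 g ⧸ mQ g χ

/-- The sum of all proper submodules of `Q(0, χ)`. -/
def maxSub (χ : RadCentralChar L) : LieSubmodule ℂ L (Q g χ) :=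
  sSup {N | N ≠ ⊤}

/-- The quotient `V(0, χ)` of `Q(0, χ)` by the sum of all its proper submodules. -/
abbrev V (χ : RadCentralChar L) : Type u := Q g χ ⧸ maxSub g χ

end GenTakiff

end

open GenTakiff

/-!
Since `r` is abelian, the image `A` of `U(r)` in `U(L)` is commutative and Noetherian. It is a sum
of finite-dimensional `g`-modules, so by Weyl's theorem it splits as `A = A^g ⊕ gA`, where `A^g` is
the purely radical part of the center and the projection `A → A^g` is `A^g`-linear (a Reynolds
operator).

Let `W` be an `L`-module with radical central character `χ` that is generated by a `g`-invariant
vector `w₀`. Then `W = A w₀`, and splitting the coefficients shows that the `g`-invariants of `W`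
are the multiples of `w₀`. A proper submodule therefore has no nonzero invariants, hence is
contained in `gW`, and the sum of all proper submodules is again proper. For a finite-dimensional
`g`-module `N` the `A`-module `Hom(N, W)` is Noetherian and `A^g` acts on it by scalars, so the
same splitting shows that its `g`-invariants are finite-dimensional, which bounds multiplicities.

Finally `Q(0, χ)` is nonzero: `Q(0)` maps to `A`, on which `L = g ⋉ r` acts by commutators and left
multiplication, and `χ` composed with the Reynolds operator kills `m_χ A` but not `1`.
-/

noncomputable section

namespace GenTakiff

universe u v w

attribute [local instance 100] LieRing.ofAssociativeRing

open Module LieModule UniversalEnvelopingAlgebra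

section Lattice

variable {R L M : Type*} [CommRing R] [LieRing L] [AddCommGroup M] [Module R M]
  [LieRingModule L M]

/-- The submodules of a Lie submodule `N` are the submodules of the ambient module below `N`. -/
def submoduleOrderIsoIic (N : LieSubmodule R L M) : LieSubmodule R L N ≃o Set.Iic N where
  toFun P := ⟨P.map N.incl, LieSubmodule.map_incl_le⟩
  invFun P := P.1.comap N.incl
  left_inv P := LieSubmodule.comap_map_eq P N.incl N.ker_incl
  right_inv P := Subtype.ext ((LieSubmodule.map_comap_incl N P).trans (inf_eq_right.mpr P.2))
  map_rel_iff' {P P'} := by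
    change P.map N.incl ≤ P'.map N.incl ↔ P ≤ P'
    rw [LieSubmodule.map_le_iff_le_comap, LieSubmodule.comap_map_eq P' N.incl N.ker_incl]

lemma isIrreducible_iff_isAtom {N : LieSubmodule R L M} :
    LieModule.IsIrreducible R L N ↔ IsAtom N :=
  (submoduleOrderIsoIic N).isSimpleOrder_iff.trans Set.isSimpleOrder_Iic_iff_isAtom

/-- The submodules of `M ⧸ N` are the submodules of `M` above `N`. -/
def quotientOrderIsoIci [LieAlgebra R L] [LieModule R L M] (N : LieSubmodule R L M) :
    LieSubmodule R L (M ⧸ N) ≃o Set.Ici N where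
  toFun P := ⟨P.comap (LieSubmodule.Quotient.mk' N), fun x hx => by
    rw [LieSubmodule.mem_comap, (LieSubmodule.Quotient.mk_eq_zero N).mpr hx]
    exact P.zero_mem⟩
  invFun P := P.1.map (LieSubmodule.Quotient.mk' N)
  left_inv P := LieSubmodule.map_comap_eq P _ (LieSubmodule.Quotient.range_mk' N ▸ le_top)
  right_inv P := Subtype.ext <| le_antisymm
    (fun x hx => by
      obtain ⟨y, hy, hxy⟩ := (LieSubmodule.mem_map _).mp hx
      have : y - x ∈ N := (LieSubmodule.Quotient.mk_eq_zero N).mp <|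
        (map_sub (LieSubmodule.Quotient.mk' N) y x).trans (sub_eq_zero.mpr hxy)
      simpa using sub_mem hy (P.2 this))
    (LieSubmodule.le_comap_map P.1 _)
  map_rel_iff' {P P'} :=
    ⟨fun h x => by
      obtain ⟨y, rfl⟩ := LieSubmodule.Quotient.surjective_mk' N x
      exact @h y, fun h _ hx => h hx⟩

lemma isIrreducible_quotient_iff_isCoatom [LieAlgebra R L] [LieModule R L M]
    {N : LieSubmodule R L M} : LieModule.IsIrreducible R L (M ⧸ N) ↔ IsCoatom N :=
  (quotientOrderIsoIci N).isSimpleOrder_iff.trans Set.isSimpleOrder_Ici_iff_isCoatom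

end Lattice

section DualBasis

variable {K V ι : Type*} [Field K] [AddCommGroup V] [Module K V] [Fintype ι] [DecidableEq ι]
  {B : LinearMap.BilinForm K V}

lemma sum_apply_smul_dualBasis (hB : B.Nondegenerate) (b : Basis ι K V) (y : V) :
    ∑ j, B y (b j) • B.dualBasis hB b j = y := by
  simpa only [LinearMap.BilinForm.dualBasis_repr_apply] using (B.dualBasis hB b).sum_repr y

lemma sum_apply_dualBasis_smul (hB : B.Nondegenerate) (hs : B.IsSymm) (b : Basis ι K V) (y : V) :
    ∑ j, B y (B.dualBasis hB b j) • b j = y := by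
  simpa only [LinearMap.BilinForm.dualBasis_dualBasis hB hs] using
    sum_apply_smul_dualBasis hB (B.dualBasis hB b) y

lemma sum_dualBasis_lie_add_sum_lie_dualBasis {g X : Type*} [LieRing g] [LieRingModule g V]
    [AddCommGroup X] [Module K X] (hB : B.Nondegenerate)
    (hs : B.IsSymm) (hinv : B.lieInvariant g) (b : Basis ι K V) (f : V →ₗ[K] V →ₗ[K] X) (x : g) :
    ∑ i, f ⁅x, b i⁆ (B.dualBasis hB b i) + ∑ i, f (b i) ⁅x, B.dualBasis hB b i⁆ = 0 := by
  set d := B.dualBasis hB b with hd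
  have expand_left (i) : f ⁅x, b i⁆ (d i) = ∑ j, B ⁅x, b i⁆ (d j) • f (b j) (d i) := by
    conv_lhs => rw [← sum_apply_dualBasis_smul hB hs b ⁅x, b i⁆]
    simp [hd]
  have expand_right (i) : f (b i) ⁅x, d i⁆ = ∑ j, B ⁅x, d i⁆ (b j) • f (b i) (d j) := by
    conv_lhs => rw [← sum_apply_smul_dualBasis hB b ⁅x, d i⁆]
    simp [hd]
  simp_rw [expand_left, expand_right]
  rw [Finset.sum_comm, ← Finset.sum_add_distrib]
  refine Finset.sum_eq_zero fun i _ => ?_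
  rw [← Finset.sum_add_distrib]
  refine Finset.sum_eq_zero fun j _ => ?_
  rw [← add_smul, hinv, hs.eq, neg_add_cancel, zero_smul]

end DualBasis

section Casimir

variable {K g X ι : Type*} [Field K] [LieRing g] [LieAlgebra K g]
  [AddCommGroup X] [Module K X] [LieRingModule g X] [LieModule K g X] [Fintype ι]

/-- The operator `∑ i, b i * d i` by which two families in an ideal `J` act on a `g`-module. It is
the Casimir operator when `b` and `d` are dual bases for an invariant form on `J`. -/
def casimir {J : LieIdeal K g} (b d : ι → J) (X : Type*) [AddCommGroup X]
    [Module K X] [LieRingModule g X] [LieModule K g X] : End K X :=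
  ∑ i, toEnd K g X (b i) * toEnd K g X (d i)

lemma casimir_apply {J : LieIdeal K g} (b d : ι → J) (v : X) :
    casimir b d X v = ∑ i, ⁅(b i : g), ⁅(d i : g), v⁆⁆ := by
  simp [casimir]

variable [DecidableEq ι]

lemma casimir_lie {J : LieIdeal K g} {B : LinearMap.BilinForm K J} (hB : B.Nondegenerate)
    (hs : B.IsSymm) (hinv : B.lieInvariant g) (b : Basis ι K J) (x : g) (v : X) :
    casimir b (B.dualBasis hB b) X ⁅x, v⁆ = ⁅x, casimir b (B.dualBasis hB b) X v⁆ := by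
  let f : J →ₗ[K] J →ₗ[K] X := LinearMap.mk₂ K (fun a c => ⁅(a : g), ⁅(c : g), v⁆⁆)
    (by simp) (by simp) (by simp) (by simp)
  have h := sum_dualBasis_lie_add_sum_lie_dualBasis hB hs hinv b f x
  simp only [f, LinearMap.mk₂_apply, LieSubmodule.coe_bracket] at h
  rw [casimir_apply, casimir_apply, lie_sum, ← sub_eq_zero, ← neg_eq_zero, ← h,
    ← Finset.sum_sub_distrib, ← Finset.sum_add_distrib, ← Finset.sum_neg_distrib]
  refine Finset.sum_congr rfl fun i _ => ?_
  rw [leibniz_lie x (b i : g), leibniz_lie x (B.dualBasis hB b i : g), lie_add]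
  abel

lemma traceForm_lieInvariant_lieIdeal (J : LieIdeal K g) :
    (traceForm K J X).lieInvariant g := fun x a c =>
  traceForm_lieInvariant K g X x (a : g) (c : g)

lemma trace_casimir_traceForm {J : LieIdeal K g} (hB : (traceForm K J X).Nondegenerate)
    (b : Basis ι K J) :
    LinearMap.trace K X (casimir b ((traceForm K J X).dualBasis hB b) X) = finrank K J := by
  have hs : (traceForm K J X).IsSymm := ⟨traceForm_comm K J X⟩
  have trace_mul (i) : LinearMap.trace K X
      (toEnd K g X (b i) * toEnd K g X ((traceForm K J X).dualBasis hB b i)) = 1 :=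
    (LinearMap.BilinForm.apply_dualBasis_right hB hs b i i).trans (if_pos rfl)
  simp [casimir, trace_mul, finrank_eq_card_basis b]

end Casimir

section Perfect

variable {K g X : Type*} [Field K] [LieRing g] [LieAlgebra K g]
  [AddCommGroup X] [Module K X] [LieRingModule g X] [LieModule K g X]

variable (K g) in
lemma lie_top_top_of_isSemisimple [LieAlgebra.IsSemisimple K g] :
    ⁅(⊤ : LieIdeal K g), (⊤ : LieIdeal K g)⁆ = ⊤ := by
  refine eq_top_iff.mpr (LieAlgebra.IsSemisimple.sSup_atoms_eq_top.ge.trans ?_)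
  refine sSup_le fun J hJ => ?_
  rw [← lie_eq_self_of_isAtom_of_nonabelian J hJ
    (LieAlgebra.IsSemisimple.non_abelian_of_isAtom J hJ)]
  exact LieSubmodule.mono_lie le_top le_top

variable (K) in
lemma lie_eq_zero_of_forall_lie_lie_eq_zero [LieAlgebra.IsSemisimple K g] {v : X}
    (h : ∀ x y : g, ⁅x, ⁅y, v⁆⁆ = 0) (x : g) : ⁅x, v⁆ = 0 := by
  have hx : x ∈ ⁅(⊤ : LieIdeal K g), (⊤ : LieIdeal K g)⁆ := by
    rw [lie_top_top_of_isSemisimple]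
    exact LieSubmodule.mem_top x
  rw [← LieSubmodule.mem_toSubmodule, LieSubmodule.lieIdeal_oper_eq_linear_span'] at hx
  refine (Submodule.span_le (p := ((toEnd K g X : g →ₗ[K] End K X).flip v).ker)).mpr ?_ hx
  rintro _ ⟨y, -, z, -, rfl⟩
  simp [h]

variable (K g X) in
lemma isTrivial_of_isNilpotent_of_isSemisimple [LieAlgebra.IsSemisimple K g]
    [LieModule.IsNilpotent g X] :
    LieModule.IsTrivial g X := by
  have descend (k : ℕ) (hk : lowerCentralSeries K g X (k + 1) = ⊥) :
      lowerCentralSeries K g X 1 = ⊥ := by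
    induction k with
    | zero => exact hk
    | succ k ih =>
      refine ih ?_
      rw [lowerCentralSeries_succ, LieSubmodule.lie_eq_bot_iff]
      refine fun x _ v hv => lie_eq_zero_of_forall_lie_lie_eq_zero K (fun y z => ?_) x
      rw [← LieSubmodule.mem_bot (R := K) (L := g), ← hk, lowerCentralSeries_succ,
        lowerCentralSeries_succ]
      exact LieSubmodule.lie_mem_lie (LieSubmodule.mem_top y)
        (LieSubmodule.lie_mem_lie (LieSubmodule.mem_top z) hv)
  obtain ⟨k, hk⟩ := IsNilpotent.nilpotent K g X
  rw [trivial_iff_lower_central_eq_bot (R := K)]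
  exact descend k (eq_bot_iff.mpr (hk ▸ antitone_lowerCentralSeries K g X k.le_succ))

lemma traceForm_nondegenerate_of_isSimple {J : Type*} [CharZero K] [LieRing J] [LieAlgebra K J]
    [LieAlgebra.IsSimple K J] [FiniteDimensional K J] [FiniteDimensional K X] [LieRingModule J X]
    [LieModule K J X] (h : ¬ LieModule.IsTrivial J X) : (traceForm K J X).Nondegenerate := by
  let radical : LieIdeal K J :=
    LieAlgebra.InvariantForm.orthogonal (traceForm K J X) (traceForm_lieInvariant K J X) ⊤
  have mem_radical (y : J) : y ∈ radical ↔ ∀ x, traceForm K J X x y = 0 := by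
    simp [radical, LieAlgebra.InvariantForm.mem_orthogonal]
  rcases LieAlgebra.IsSimple.eq_bot_or_eq_top radical with hbot | htop
  · refine (traceForm_isSymm K J X).isRefl.nondegenerate_iff_separatingRight.mpr fun y hy => ?_
    simpa only [hbot, LieSubmodule.mem_bot] using (mem_radical y).mpr hy
  · have traceForm_eq_zero : traceForm K J X = 0 := LinearMap.ext₂ fun x y =>
      (mem_radical y).mp (htop ▸ LieSubmodule.mem_top y) x
    have nilpotent := isNilpotent_derivedSeries_of_traceForm_eq_zero traceForm_eq_zero
    rw [LieAlgebra.derivedSeries_def, LieAlgebra.derivedSeriesOfIdeal_succ,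
      LieAlgebra.derivedSeriesOfIdeal_zero, lie_top_top_of_isSemisimple] at nilpotent
    have : LieModule.IsNilpotent J X :=
      (isNilpotent_of_top_iff (R := K) (L := J) (M := X)).mp nilpotent
    exact absurd (isTrivial_of_isNilpotent_of_isSemisimple K J X) h

end Perfect

section Cohomology

variable {K g X : Type*} [Field K] [LieRing g] [LieAlgebra K g]
  [AddCommGroup X] [Module K X] [LieRingModule g X] [LieModule K g X]

lemma exists_isAtom_not_isTrivial [LieAlgebra.IsSemisimple K g] (h : ¬ LieModule.IsTrivial g X) :
    ∃ J : LieIdeal K g, IsAtom J ∧ ¬ LieModule.IsTrivial J X := by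
  contrapose! h
  have ker_eq_top : (toEnd K g X).ker = ⊤ := by
    refine eq_top_iff.mpr (LieAlgebra.IsSemisimple.sSup_atoms_eq_top.ge.trans ?_)
    refine sSup_le fun J hJ x hx => ?_
    have := h J hJ
    exact LinearMap.ext fun v => LieModule.IsTrivial.trivial (⟨x, hx⟩ : J) v
  refine ⟨fun x v => ?_⟩
  have hx : x ∈ (toEnd K g X).ker := ker_eq_top ▸ LieSubmodule.mem_top x
  exact LinearMap.congr_fun hx v

lemma finrank_map_mk'_lt {W W' : LieSubmodule K g X} [FiniteDimensional K W] (hle : W' ≤ W)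
    (hbot : W' ≠ ⊥) : finrank K (W.map (LieSubmodule.Quotient.mk' W')) < finrank K W := by
  let q := (LieSubmodule.Quotient.mk' W' : X →ₗ[K] X ⧸ W').domRestrict W.toSubmodule
  have range_q : q.range = (W.map (LieSubmodule.Quotient.mk' W')).toSubmodule :=
    LinearMap.range_domRestrict _ _
  have ker_q : q.ker ≠ ⊥ := fun h => hbot <| (LieSubmodule.eq_bot_iff _).mpr fun u hu => by
    have : (⟨u, hle hu⟩ : W.toSubmodule) ∈ q.ker :=
      (LieSubmodule.Quotient.mk_eq_zero W').mpr hu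
    simpa [h] using this
  have rank_nullity := q.finrank_range_add_finrank_ker
  have ker_pos := Submodule.one_le_finrank_iff.mpr ker_q
  rw [range_q] at rank_nullity
  change finrank K (W.map _).toSubmodule < finrank K W.toSubmodule
  omega

variable [CharZero K] [FiniteDimensional K g]

lemma exists_injective_casimir [LieAlgebra.IsSemisimple K g] [FiniteDimensional K X]
    [LieModule.IsIrreducible K g X] (h : ¬ LieModule.IsTrivial g X) :
    ∃ (J : LieIdeal K g) (b : Basis (Fin (finrank K J)) K J)
      (hB : (traceForm K J X).Nondegenerate),
      Function.Injective (casimir b ((traceForm K J X).dualBasis hB b) X) := by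
  obtain ⟨J, hJ, hJX⟩ := exists_isAtom_not_isTrivial (K := K) h
  have := LieAlgebra.IsSemisimple.isSimple_of_isAtom J hJ
  have hB := traceForm_nondegenerate_of_isSimple (K := K) hJX
  let b := finBasis K J
  refine ⟨J, b, hB, ?_⟩
  let c : X →ₗ⁅K,g⁆ X :=
    { casimir b ((traceForm K J X).dualBasis hB b) X with
      map_lie' := casimir_lie hB ⟨traceForm_comm K J X⟩ (traceForm_lieInvariant_lieIdeal J) b _ _ }
  have trace_ne_zero : LinearMap.trace K X c ≠ 0 := by
    have : Nontrivial J := LieAlgebra.IsSimple.nontrivial K J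
    rw [show (c : X →ₗ[K] X) = _ from rfl, trace_casimir_traceForm hB b]
    exact_mod_cast finrank_pos.ne'
  have ker_eq_bot : c.ker = ⊥ := (IsSimpleOrder.eq_bot_or_eq_top c.ker).resolve_right fun htop =>
    trace_ne_zero <| by
      rw [LinearMap.ker_eq_top.mp (congrArg LieSubmodule.toSubmodule htop), map_zero]
  exact c.ker_eq_bot.mp ker_eq_bot

lemma exists_sub_mem_maxTrivSubmodule_of_isIrreducible [LieAlgebra.IsSemisimple K g]
    (W : LieSubmodule K g X) [FiniteDimensional K W] [LieModule.IsIrreducible K g W] {v : X}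
    (hv : ∀ x : g, ⁅x, v⁆ ∈ W) : ∃ w ∈ W, v - w ∈ maxTrivSubmodule K g X := by
  by_cases hW : LieModule.IsTrivial g W
  · refine ⟨0, W.zero_mem, ?_⟩
    rw [sub_zero, mem_maxTrivSubmodule]
    exact lie_eq_zero_of_forall_lie_lie_eq_zero K fun x y =>
      congrArg Subtype.val (LieModule.IsTrivial.trivial x (⟨⁅y, v⁆, hv y⟩ : W))
  obtain ⟨J, b, hB, hinj⟩ := exists_injective_casimir (K := K) hW
  set d := (traceForm K J W).dualBasis hB b
  have coe_casimir (w : W) : (casimir b d W w : X) = casimir b d X w := by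
    simp [casimir_apply]
  have casimir_v_mem : casimir b d X v ∈ W := by
    rw [casimir_apply]
    exact sum_mem fun i _ => W.lie_mem (hv _)
  obtain ⟨w, hw⟩ := LinearMap.injective_iff_surjective.mp hinj ⟨_, casimir_v_mem⟩
  refine ⟨w, w.2, fun x => ?_⟩
  have hmem : ⁅x, v - (w : X)⁆ ∈ W := by
    rw [lie_sub]
    exact sub_mem (hv x) (W.lie_mem w.2)
  have hzero : casimir b d W ⟨_, hmem⟩ = 0 := Subtype.ext <| by
    rw [coe_casimir, casimir_lie hB ⟨traceForm_comm K J W⟩ (traceForm_lieInvariant_lieIdeal J),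
      map_sub, ← coe_casimir, hw, sub_self, lie_zero, ZeroMemClass.coe_zero]
  exact congrArg Subtype.val (hinj (hzero.trans (map_zero _).symm))

/-- The first cohomology of a semisimple Lie algebra in a finite-dimensional module `W` vanishes:
a vector spanning a trivial submodule modulo `W` can be corrected to an invariant one. -/
theorem exists_sub_mem_maxTrivSubmodule [LieAlgebra.IsSemisimple K g] (W : LieSubmodule K g X)
    [FiniteDimensional K W] {v : X} (hv : ∀ x : g, ⁅x, v⁆ ∈ W) :
    ∃ w ∈ W, v - w ∈ maxTrivSubmodule K g X := by
  induction hn : finrank K W using Nat.strong_induction_on generalizing X with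
  | _ n ih =>
  subst hn
  by_cases hW : W = ⊥
  · exact ⟨0, W.zero_mem, fun x => by simpa [hW] using hv x⟩
  by_cases hatom : IsAtom W
  · have := isIrreducible_iff_isAtom.mpr hatom
    exact exists_sub_mem_maxTrivSubmodule_of_isIrreducible W hv
  obtain ⟨W', hlt, hbot⟩ : ∃ W' < W, W' ≠ ⊥ := by
    simpa [IsAtom, hW] using hatom
  have : FiniteDimensional K W' := Submodule.finiteDimensional_of_le hlt.le
  let q := LieSubmodule.Quotient.mk' W'
  have : FiniteDimensional K (W.map q) :=
    inferInstanceAs (FiniteDimensional K (W.toSubmodule.map (q : X →ₗ[K] X ⧸ W')))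
  obtain ⟨_, hw, hqv⟩ := ih _ (finrank_map_mk'_lt hlt.le hbot) (W.map q) (v := q v)
    (fun x => q.map_lie x v ▸ LieSubmodule.mem_map_of_mem (hv x)) rfl
  obtain ⟨w, hwW, rfl⟩ := (LieSubmodule.mem_map _).mp hw
  obtain ⟨w', hw', hvw'⟩ := ih _ (Submodule.finrank_lt_finrank_of_lt hlt) W' (v := v - w)
    (fun x => by
      rw [← LieSubmodule.Quotient.mk_eq_zero, LieModuleHom.map_lie, map_sub]
      exact hqv x) rfl
  exact ⟨w + w', add_mem hwW (hlt.le hw'), by rwa [← sub_sub]⟩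

end Cohomology

section CompleteReducibility

variable {K g X : Type*} [Field K] [CharZero K] [LieRing g] [LieAlgebra K g]
  [FiniteDimensional K g] [LieAlgebra.IsSemisimple K g]
  [AddCommGroup X] [Module K X] [LieRingModule g X] [LieModule K g X]

theorem exists_leftInverse_incl [FiniteDimensional K X] (N : LieSubmodule K g X) :
    ∃ r : X →ₗ⁅K,g⁆ N, ∀ y : N, r y = y := by
  let W : LieSubmodule K g (X →ₗ[K] N) :=
    { LinearMap.ker (LinearMap.lcomp K N N.toSubmodule.subtype) with
      lie_mem := fun {x f} hf => LinearMap.ext fun y => by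
        have hf (y : N) : f y = 0 := LinearMap.congr_fun hf y
        have := hf ⁅x, y⁆
        rw [LieSubmodule.coe_bracket] at this
        simp [hf y, this] }
  obtain ⟨p, hp⟩ := LinearMap.exists_leftInverse_of_injective N.toSubmodule.subtype
    N.toSubmodule.ker_subtype
  have hp (y : N) : p y = y := LinearMap.congr_fun hp y
  obtain ⟨w, hw, hinv⟩ := exists_sub_mem_maxTrivSubmodule W (v := p) fun x =>
    LinearMap.ext fun y => by
      have := hp ⁅x, y⁆
      rw [LieSubmodule.coe_bracket] at this
      simp [hp y, this]
  refine ⟨maxTrivLinearMapEquivLieModuleHom ⟨p - w, hinv⟩, fun y => ?_⟩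
  have hw (y : N) : w y = 0 := LinearMap.congr_fun hw y
  change p y - w y = y
  rw [hp, hw, sub_zero]

/-- Weyl's theorem on complete reducibility. -/
theorem complementedLattice_of_finiteDimensional [FiniteDimensional K X] :
    ComplementedLattice (LieSubmodule K g X) := by
  refine ⟨fun N => ?_⟩
  obtain ⟨r, hr⟩ := exists_leftInverse_incl N
  refine ⟨r.ker, LieSubmodule.isCompl_toSubmodule.mp ?_⟩
  exact LinearMap.isCompl_of_proj hr

end CompleteReducibility

section Splitting

variable {R L M M' : Type*} [CommRing R] [LieRing L] [LieAlgebra R L]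
  [AddCommGroup M] [Module R M] [LieRingModule L M] [LieModule R L M]
  [AddCommGroup M'] [Module R M'] [LieRingModule L M'] [LieModule R L M']

lemma isCompl_maxTrivSubmodule_lie_top [ComplementedLattice (LieSubmodule R L M)] :
    IsCompl (maxTrivSubmodule R L M) ⁅(⊤ : LieIdeal R L), (⊤ : LieSubmodule R L M)⁆ := by
  constructor
  · obtain ⟨C, hC⟩ := exists_isCompl (maxTrivSubmodule R L M)
    have hle : ⁅(⊤ : LieIdeal R L), (⊤ : LieSubmodule R L M)⁆ ≤ C := by
      rw [← hC.sup_eq_top, LieSubmodule.lie_sup,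
        (le_max_triv_iff_bracket_eq_bot R L M).mp le_rfl, bot_sup_eq]
      exact LieSubmodule.lie_le_right C ⊤
    exact hC.disjoint.mono_right hle
  · obtain ⟨C, hC⟩ := exists_isCompl ⁅(⊤ : LieIdeal R L), (⊤ : LieSubmodule R L M)⁆
    have hle : C ≤ maxTrivSubmodule R L M := by
      rw [le_max_triv_iff_bracket_eq_bot, ← le_bot_iff, ← hC.inf_eq_bot]
      exact le_inf (LieSubmodule.mono_lie_right ⊤ le_top) (LieSubmodule.lie_le_right C ⊤)
    exact (hC.codisjoint.mono_right hle).symm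

variable (R L) in
lemma exists_mem_maxTrivSubmodule_add_eq [ComplementedLattice (LieSubmodule R L M)] (m : M) :
    ∃ s ∈ maxTrivSubmodule R L M, ∃ t ∈ ⁅(⊤ : LieIdeal R L), (⊤ : LieSubmodule R L M)⁆,
      s + t = m := by
  rw [← LieSubmodule.mem_sup, isCompl_maxTrivSubmodule_lie_top.sup_eq_top]
  exact LieSubmodule.mem_top m

lemma map_mem_lie_top (f : M →ₗ⁅R,L⁆ M') {m : M}
    (hm : m ∈ ⁅(⊤ : LieIdeal R L), (⊤ : LieSubmodule R L M)⁆) :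
    f m ∈ ⁅(⊤ : LieIdeal R L), (⊤ : LieSubmodule R L M')⁆ := by
  have h := LieSubmodule.mem_map_of_mem (f := f) hm
  rw [LieSubmodule.map_bracket_eq] at h
  exact LieSubmodule.mono_lie_right ⊤ le_top h

end Splitting

section LocallyFinite

variable (K g X : Type*) [Field K] [LieRing g] [AddCommGroup X] [Module K X] [LieRingModule g X]

/-- A module is locally finite if each of its vectors lies in a finite-dimensional submodule. -/
def IsLocallyFinite : Prop :=
  ∀ v : X, ∃ F : LieSubmodule K g X, FiniteDimensional K F ∧ v ∈ F

variable {K g X} {Y : Type*} [AddCommGroup Y] [Module K Y] [LieRingModule g Y]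

lemma IsLocallyFinite.of_surjective (h : IsLocallyFinite K g X) (f : X →ₗ⁅K,g⁆ Y)
    (hf : Function.Surjective f) : IsLocallyFinite K g Y := fun y => by
  obtain ⟨v, rfl⟩ := hf y
  obtain ⟨F, hF, hv⟩ := h v
  exact ⟨F.map f, inferInstanceAs (FiniteDimensional K (F.toSubmodule.map (f : X →ₗ[K] Y))),
    LieSubmodule.mem_map_of_mem hv⟩

lemma IsLocallyFinite.of_injective (h : IsLocallyFinite K g Y) (f : X →ₗ⁅K,g⁆ Y)
    (hf : Function.Injective f) : IsLocallyFinite K g X := fun x => by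
  obtain ⟨F, hF, hx⟩ := h (f x)
  have : FiniteDimensional K F.toSubmodule := hF
  let e : F.comap f →ₗ[K] F.toSubmodule :=
    (f : X →ₗ[K] Y).restrict (p := (F.comap f).toSubmodule) (q := F.toSubmodule) fun _ hy => hy
  exact ⟨F.comap f, FiniteDimensional.of_injective e fun y z hyz =>
    Subtype.ext (hf (congrArg Subtype.val hyz)), hx⟩

lemma finiteDimensional_sup (F F' : LieSubmodule K g X) [FiniteDimensional K F]
    [FiniteDimensional K F'] : FiniteDimensional K (F ⊔ F' : LieSubmodule K g X) := by
  change FiniteDimensional K (F ⊔ F' : LieSubmodule K g X).toSubmodule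
  rw [LieSubmodule.sup_toSubmodule]
  exact Submodule.finiteDimensional_sup _ _

lemma IsLocallyFinite.exists_forall_mem (h : IsLocallyFinite K g X) {ι : Type*} [Finite ι]
    (v : ι → X) : ∃ F : LieSubmodule K g X, FiniteDimensional K F ∧ ∀ i, v i ∈ F := by
  choose F hF hv using fun i => h (v i)
  have hfd : ∀ s : Finset ι, FiniteDimensional K (s.sup F : LieSubmodule K g X) := fun s =>
    Finset.sup_induction (p := fun F : LieSubmodule K g X => FiniteDimensional K F)
      (inferInstanceAs (FiniteDimensional K (⊥ : Submodule K X)))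
      (fun _ _ _ _ => finiteDimensional_sup _ _) fun i _ => hF i
  have := Fintype.ofFinite ι
  exact ⟨Finset.univ.sup F, hfd _, fun i => Finset.le_sup (f := F) (Finset.mem_univ i) (hv i)⟩

variable [LieAlgebra K g] [LieModule K g X]

lemma IsLocallyFinite.linearMap (h : IsLocallyFinite K g X) [LieModule K g Y]
    [FiniteDimensional K Y] : IsLocallyFinite K g (Y →ₗ[K] X) := fun f => by
  let b := finBasis K Y
  obtain ⟨F, hF, hb⟩ := h.exists_forall_mem (f ∘ b)
  let φ : (Y →ₗ[K] F) →ₗ⁅K,g⁆ (Y →ₗ[K] X) :=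
    { LinearMap.compRight K (F.incl : F →ₗ[K] X) with
      map_lie' := fun {x h} => rfl }
  have hfF : ∀ y, f y ∈ F := fun y => by
    rw [← b.sum_repr y, map_sum]
    simp_rw [map_smul]
    exact sum_mem fun i _ => F.smul_mem _ (hb i)
  exact ⟨φ.range,
    inferInstanceAs (FiniteDimensional K (LinearMap.range (φ : (Y →ₗ[K] F) →ₗ[K] (Y →ₗ[K] X)))),
    (f.codRestrict F.toSubmodule hfF : Y →ₗ[K] F), rfl⟩

lemma IsLocallyFinite.complementedLattice [CharZero K] [FiniteDimensional K g]
    [LieAlgebra.IsSemisimple K g] (h : IsLocallyFinite K g X) :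
    ComplementedLattice (LieSubmodule K g X) := by
  refine complementedLattice_of_complementedLattice_Iic
    (s := {F : LieSubmodule K g X | FiniteDimensional K F}) (f := id) (fun F hF => ?_) ?_
  · have : FiniteDimensional K F := hF
    exact (submoduleOrderIsoIic F).complementedLattice_iff.mp
      complementedLattice_of_finiteDimensional
  · refine eq_top_iff.mpr fun v _ => ?_
    obtain ⟨F, hF, hv⟩ := h v
    exact le_biSup (s := {F : LieSubmodule K g X | FiniteDimensional K F}) id hF hv

end LocallyFinite

section LocallyFiniteAtoms

variable {K g X : Type*} [Field K] [LieRing g] [AddCommGroup X] [Module K X] [LieRingModule g X]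

lemma IsLocallyFinite.finiteDimensional_of_isAtom (h : IsLocallyFinite K g X)
    {N : LieSubmodule K g X} (hN : IsAtom N) : FiniteDimensional K N := by
  obtain ⟨v, hv, hv0⟩ : ∃ v ∈ N, v ≠ 0 := by
    simpa only [ne_eq, LieSubmodule.eq_bot_iff, not_forall, exists_prop] using hN.1
  obtain ⟨F, hF, hvF⟩ := h v
  have hle : N ≤ F := hN.not_disjoint_iff_le.mp fun hd =>
    hv0 ((LieSubmodule.mem_bot v).mp (hd.le_bot ⟨hv, hvF⟩))
  have : FiniteDimensional K F.toSubmodule := hF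
  exact Submodule.finiteDimensional_of_le (show N.toSubmodule ≤ F.toSubmodule from hle)

variable [LieAlgebra K g] [LieModule K g X]

lemma finite_setOf_equiv {S : Set (LieSubmodule K g X)} (hS : sSupIndep S)
    {N : LieSubmodule K g X} (hN : N ≠ ⊥) [FiniteDimensional K (N →ₗ⁅K,g⁆ X)] :
    {N' ∈ S | Nonempty (N' ≃ₗ⁅K,g⁆ N)}.Finite := by
  set T := {N' ∈ S | Nonempty (N' ≃ₗ⁅K,g⁆ N)}
  obtain ⟨n, hn⟩ : ∃ n : N, n ≠ 0 :=
    have := (LieSubmodule.nontrivial_iff_ne_bot K g X).mpr hN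
    exists_ne 0
  let e (N' : T) : N'.1 ≃ₗ⁅K,g⁆ N := N'.2.2.some
  let f (N' : T) : N →ₗ⁅K,g⁆ X := N'.1.incl.comp ((e N').symm : N →ₗ⁅K,g⁆ N'.1)
  have hind : iSupIndep fun N' : T => N'.1.toSubmodule := by
    rw [LieSubmodule.iSupIndep_toSubmodule]
    exact (sSupIndep_iff _).mp (hS.mono fun N' h => h.1)
  let eval : (N →ₗ⁅K,g⁆ X) →ₗ[K] X :=
    { toFun := fun h => h n
      map_add' := fun _ _ => rfl
      map_smul' := fun _ _ => rfl }
  have hlin : LinearIndependent K f := by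
    refine .of_comp eval (hind.linearIndependent _ (fun N' => ((e N').symm n).2) fun N' h0 => hn ?_)
    rw [← (e N').apply_symm_apply n, show (e N').symm n = 0 from Subtype.ext h0]
    exact map_zero (e N' : N'.1 →ₗ⁅K,g⁆ N)
  have : Finite T := hlin.finite
  exact Set.toFinite T

end LocallyFiniteAtoms

section EquivariantModule

/-- The Lie algebra `g` acts on the `A`-module `W` compatibly with its action on the ring `A`, in
the sense of the Leibniz rule. -/
class IsLieEquivariant (g A W : Type*) [LieRing g] [Ring A] [LieRingModule g A]
    [AddCommGroup W] [LieRingModule g W] [Module A W] : Prop where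
  lie_smul_eq (x : g) (a : A) (m : W) : ⁅x, a • m⁆ = ⁅x, a⁆ • m + a • ⁅x, m⁆

instance {R L A W : Type*} [CommRing R] [LieRing L] [LieAlgebra R L] [Ring A] [LieRingModule L A]
    [AddCommGroup W] [LieRingModule L W] [Module A W] [IsLieEquivariant L A W]
    (g : LieSubalgebra R L) : IsLieEquivariant g A W where
  lie_smul_eq x := IsLieEquivariant.lie_smul_eq (x : L)

variable {K g A W : Type*} [Field K] [LieRing g] [LieAlgebra K g]
  [Ring A] [Algebra K A] [LieRingModule g A] [LieModule K g A]
  [AddCommGroup W] [Module K W] [LieRingModule g W] [LieModule K g W]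
  [Module A W] [IsScalarTower K A W] [IsLieEquivariant g A W]

/-- The `g`-equivariant orbit map `a ↦ a • w` of a `g`-invariant vector `w`. -/
def orbitMap (w : maxTrivSubmodule K g W) : A →ₗ⁅K,g⁆ W :=
  { (LinearMap.toSpanSingleton A W (w : W)).restrictScalars K with
    map_lie' := fun {x a} => by
      have hw : ⁅x, (w : W)⁆ = 0 := w.2 x
      change ⁅x, a⁆ • (w : W) = ⁅x, a • (w : W)⁆
      rw [IsLieEquivariant.lie_smul_eq, hw, smul_zero, add_zero] }

variable [ComplementedLattice (LieSubmodule K g A)] [ComplementedLattice (LieSubmodule K g W)]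
  (hs : ∀ a ∈ maxTrivSubmodule K g A, ∃ c : K, ∀ m : W, a • m = c • m)

include hs

/- Splitting each coefficient `a ∈ A` into an invariant, which acts by a scalar, and an element of
`g A`, changes an `A`-linear combination of invariants into a `K`-linear one modulo `g W`. -/
lemma maxTrivSubmodule_le_span {t : Set W} (ht : t ⊆ maxTrivSubmodule K g W)
    (hspan : (maxTrivSubmodule K g W : Set W) ⊆ Submodule.span A t) :
    (maxTrivSubmodule K g W).toSubmodule ≤ Submodule.span K t := by
  let gW := ⁅(⊤ : LieIdeal K g), (⊤ : LieSubmodule K g W)⁆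
  have hmod : ∀ m ∈ Submodule.span A t, m ∈ Submodule.span K t ⊔ gW.toSubmodule := fun m hm => by
    induction hm using Submodule.closure_induction with
    | zero => exact zero_mem _
    | add m m' _ _ hm hm' => exact add_mem hm hm'
    | smul_mem a m hm =>
      obtain ⟨s, hs', r, hr, rfl⟩ := exists_mem_maxTrivSubmodule_add_eq K g a
      obtain ⟨c, hc⟩ := hs s hs'
      rw [add_smul, hc]
      exact Submodule.add_mem_sup (Submodule.smul_mem _ c (Submodule.subset_span hm))
        (map_mem_lie_top (orbitMap ⟨m, ht hm⟩) hr)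
  have hle := le_inf (fun m hm => hmod m (hspan hm)) (le_refl (maxTrivSubmodule K g W).toSubmodule)
  rwa [sup_inf_assoc_of_le _ (Submodule.span_le.mpr ht), inf_comm,
    (LieSubmodule.isCompl_toSubmodule.mpr isCompl_maxTrivSubmodule_lie_top).inf_eq_bot,
    sup_bot_eq] at hle

lemma finiteDimensional_maxTrivSubmodule [IsNoetherian A W] :
    FiniteDimensional K (maxTrivSubmodule K g W) := by
  obtain ⟨t, ht, hspan⟩ := (Submodule.fg_span_iff_fg_span_finset_subset _).mp
    (IsNoetherian.noetherian (Submodule.span A (maxTrivSubmodule K g W : Set W)))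
  exact Submodule.finiteDimensional_of_le
    (maxTrivSubmodule_le_span hs ht (hspan ▸ Submodule.subset_span))

end EquivariantModule

section EquivariantAlgebra

variable {K g A : Type*} [Field K] [LieRing g] [LieAlgebra K g]
  [Ring A] [Algebra K A] [LieRingModule g A] [LieModule K g A] [IsLieEquivariant g A A]

variable (K) in
lemma lie_algebraMap (x : g) (t : K) : ⁅x, algebraMap K A t⁆ = 0 := by
  have h1 : ⁅x, (1 : A)⁆ = 0 := by
    simpa using IsLieEquivariant.lie_smul_eq x (1 : A) (1 : A)
  rw [Algebra.algebraMap_eq_smul_one, lie_smul t, h1, smul_zero]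

lemma lie_mul (x : g) (a b : A) : ⁅x, a * b⁆ = ⁅x, a⁆ * b + a * ⁅x, b⁆ :=
  IsLieEquivariant.lie_smul_eq x a b

lemma lie_mem_adjoin (F : LieSubmodule K g A) (x : g) {a : A}
    (ha : a ∈ Algebra.adjoin K (F : Set A)) : ⁅x, a⁆ ∈ Algebra.adjoin K (F : Set A) := by
  induction ha using Algebra.adjoin_induction with
  | mem a ha => exact Algebra.subset_adjoin (F.lie_mem ha)
  | algebraMap t => rw [lie_algebraMap]; exact zero_mem _
  | add a b _ _ ha hb => rw [lie_add]; exact add_mem ha hb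
  | mul a b ha hb hxa hxb => rw [lie_mul]; exact add_mem (mul_mem hxa hb) (mul_mem ha hxb)

/-- The product of two submodules of an algebra on which `g` acts by derivations. -/
def lieSubmoduleMul (F F' : LieSubmodule K g A) : LieSubmodule K g A :=
  { F.toSubmodule * F'.toSubmodule with
    lie_mem := fun {x c} hc => by
      induction hc using Submodule.mul_induction_on' with
      | mem_mul_mem a ha b hb =>
        rw [lie_mul]
        exact Submodule.add_mem _ (Submodule.mul_mem_mul (F.lie_mem ha) hb)
          (Submodule.mul_mem_mul ha (F'.lie_mem hb))
      | add a _ b _ ha hb => rw [lie_add]; exact Submodule.add_mem _ ha hb }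

lemma isLocallyFinite_of_adjoin_eq_top {F : LieSubmodule K g A} [hF : FiniteDimensional K F]
    (h : Algebra.adjoin K (F : Set A) = ⊤) : IsLocallyFinite K g A := fun a => by
  have ha : a ∈ Algebra.adjoin K (F : Set A) := h ▸ Algebra.mem_top
  induction ha using Algebra.adjoin_induction with
  | mem a ha => exact ⟨F, hF, ha⟩
  | algebraMap t =>
    let scalars : LieSubmodule K g A :=
      { (⊥ : Subalgebra K A).toSubmodule with
        lie_mem := fun {x c} hc => by
          obtain ⟨t, rfl⟩ := Algebra.mem_bot.mp hc
          rw [lie_algebraMap]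
          exact Submodule.zero_mem _ }
    exact ⟨scalars, inferInstanceAs (FiniteDimensional K (⊥ : Subalgebra K A)),
      Algebra.mem_bot.mpr ⟨t, rfl⟩⟩
  | add a b _ _ ha hb =>
    obtain ⟨F, hF, haF⟩ := ha
    obtain ⟨F', hF', hbF'⟩ := hb
    exact ⟨F ⊔ F', finiteDimensional_sup F F', add_mem (le_sup_left (a := F) haF)
      (le_sup_right (a := F) hbF')⟩
  | mul a b _ _ ha hb =>
    obtain ⟨F, hF, haF⟩ := ha
    obtain ⟨F', hF', hbF'⟩ := hb
    exact ⟨lieSubmoduleMul F F', Module.Finite.iff_fg.mpr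
      ((Module.Finite.iff_fg.mp hF).mul (Module.Finite.iff_fg.mp hF')),
      Submodule.mul_mem_mul haF hbF'⟩

end EquivariantAlgebra

section EquivariantHom

variable {K g A N W : Type*} [Field K] [LieRing g] [LieAlgebra K g]
  [Ring A] [Algebra K A] [LieRingModule g A] [LieModule K g A]
  [AddCommGroup N] [Module K N] [LieRingModule g N] [LieModule K g N]
  [AddCommGroup W] [Module K W] [LieRingModule g W] [LieModule K g W]
  [Module A W] [IsScalarTower K A W] [IsLieEquivariant g A W]

instance : IsLieEquivariant g A (N →ₗ[K] W) where
  lie_smul_eq x a f := LinearMap.ext fun n => by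
    simp only [LieHom.lie_apply, LinearMap.smul_apply, LinearMap.add_apply,
      IsLieEquivariant.lie_smul_eq, smul_sub]
    abel

lemma finiteDimensional_lieModuleHom [CharZero K] [FiniteDimensional K g]
    [LieAlgebra.IsSemisimple K g] [FiniteDimensional K N] [IsNoetherian A W]
    (hA : IsLocallyFinite K g A) (hW : IsLocallyFinite K g W)
    (hs : ∀ a ∈ maxTrivSubmodule K g A, ∃ c : K, ∀ m : W, a • m = c • m) :
    FiniteDimensional K (N →ₗ⁅K,g⁆ W) := by
  have := hA.complementedLattice
  have := (hW.linearMap (Y := N)).complementedLattice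
  have : IsNoetherian A (N →ₗ[K] W) := isNoetherian_of_linearEquiv ((finBasis K N).constr A)
  have := finiteDimensional_maxTrivSubmodule (W := N →ₗ[K] W) fun a ha =>
    (hs a ha).imp fun c hc f => LinearMap.ext fun n => hc (f n)
  exact maxTrivLinearMapEquivLieModuleHom.finiteDimensional

end EquivariantHom

section EnvelopingAlgebra

variable {R L : Type*} [CommRing R] [LieRing L] [LieAlgebra R L]

variable (R L) in
lemma adjoin_range_ι :
    Algebra.adjoin R (Set.range (ι R : L → UniversalEnvelopingAlgebra R L)) = ⊤ := by
  let S := Algebra.adjoin R (Set.range (ι R : L → UniversalEnvelopingAlgebra R L))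
  let f : L →ₗ⁅R⁆ S :=
    { toFun := fun x => ⟨ι R x, Algebra.subset_adjoin ⟨x, rfl⟩⟩
      map_add' := fun x y => Subtype.ext (map_add _ _ _)
      map_smul' := fun t x => Subtype.ext (map_smul _ _ _)
      map_lie' := fun {x y} => Subtype.ext (LieHom.map_lie _ _ _) }
  have hid : S.val.comp (lift R f) = AlgHom.id R _ := by
    ext x
    exact congrArg Subtype.val (lift_ι_apply R f x)
  refine eq_top_iff.mpr fun a _ => ?_
  rw [show a = lift R f a from (AlgHom.congr_fun hid a).symm]
  exact (lift R f a).2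

lemma universalEnvelopingAlgebra_induction {p : UniversalEnvelopingAlgebra R L → Prop}
    (ι : ∀ x, p (ι R x)) (algebraMap : ∀ t, p (algebraMap R _ t))
    (add : ∀ a b, p a → p b → p (a + b)) (mul : ∀ a b, p a → p b → p (a * b)) (a) : p a := by
  have ha := adjoin_range_ι R L ▸ Algebra.mem_top (x := a)
  induction ha using Algebra.adjoin_induction with
  | mem a ha => obtain ⟨x, rfl⟩ := ha; exact ι x
  | algebraMap t => exact algebraMap t
  | add a b _ _ ha hb => exact add a b ha hb
  | mul a b _ _ ha hb => exact mul a b ha hb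

end EnvelopingAlgebra

section EnvelopingAction

variable {L : Type u} [LieRing L] [LieAlgebra ℂ L]
variable {W : Type v} [AddCommGroup W] [Module ℂ W] [LieRingModule L W] [LieModule ℂ L W]
  {W' : Type w} [AddCommGroup W'] [Module ℂ W'] [LieRingModule L W'] [LieModule ℂ L W']

lemma uAct_ι (x : L) (m : W) : uAct L W (ι ℂ x) m = ⁅x, m⁆ := by
  rw [uAct, lift_ι_apply, toEnd_apply_apply]

lemma uAct_mem (N : LieSubmodule ℂ L W) (a : U L) {m : W} (hm : m ∈ N) : uAct L W a m ∈ N := by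
  induction a using universalEnvelopingAlgebra_induction generalizing m with
  | ι x => rw [uAct_ι]; exact N.lie_mem hm
  | algebraMap t => rw [AlgHom.commutes]; exact N.smul_mem t hm
  | add a b ha hb => rw [map_add]; exact add_mem (ha hm) (hb hm)
  | mul a b ha hb => rw [map_mul]; exact ha (hb hm)

lemma uAct_map (f : W →ₗ⁅ℂ,L⁆ W') (a : U L) (m : W) : f (uAct L W a m) = uAct L W' a (f m) := by
  induction a using universalEnvelopingAlgebra_induction generalizing m with
  | ι x => rw [uAct_ι, uAct_ι, LieModuleHom.map_lie]
  | algebraMap t => simp only [AlgHom.commutes, Module.algebraMap_end_apply, map_smul]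
  | add a b ha hb => simp only [map_add, LinearMap.add_apply, ha, hb]
  | mul a b ha hb => simp only [map_mul, Module.End.mul_apply, ha, hb]

lemma HasRadCentralChar.of_surjective {χ : RadCentralChar L} (h : HasRadCentralChar χ W)
    (f : W →ₗ⁅ℂ,L⁆ W') (hf : Function.Surjective f) : HasRadCentralChar χ W' := fun z m => by
  obtain ⟨m, rfl⟩ := hf m
  rw [← uAct_map, h, map_smul]

/-- The adjoint action of `L` on `U(L)`, that is `⁅x, a⁆ = x a - a x`. -/
instance : LieRingModule L (U L) := LieRingModule.compLieHom (U L) (ι ℂ : L →ₗ⁅ℂ⁆ U L)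

instance : LieModule ℂ L (U L) := LieModule.compLieHom (U L) (ι ℂ : L →ₗ⁅ℂ⁆ U L)

instance : IsLieEquivariant L (U L) (U L) where
  lie_smul_eq x a b := by
    change ι ℂ x * (a * b) - a * b * ι ℂ x =
      (ι ℂ x * a - a * ι ℂ x) * b + a * (ι ℂ x * b - b * ι ℂ x)
    noncomm_ring

variable (L) in
/-- The map `ι : L → U(L)` as a homomorphism from the adjoint module. -/
def ιHom : L →ₗ⁅ℂ,L⁆ U L := { (ι ℂ : L →ₗ⁅ℂ⁆ U L) with map_lie' := LieHom.map_lie _ _ _ }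

lemma isLocallyFinite_U [FiniteDimensional ℂ L] : IsLocallyFinite ℂ L (U L) := by
  have : FiniteDimensional ℂ (ιHom L).range :=
    inferInstanceAs (FiniteDimensional ℂ (LinearMap.range (ιHom L : L →ₗ[ℂ] U L)))
  exact isLocallyFinite_of_adjoin_eq_top (F := (ιHom L).range) (adjoin_range_ι ℂ L)

end EnvelopingAction

section RadicalAlgebra

variable (L : Type u) [LieRing L] [LieAlgebra ℂ L]

/-- The image of `U(r)` in `U(L)`, where `r` is the radical of `L`. -/
abbrev radAlg : Subalgebra ℂ (U L) := (uRadIncl L).range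

/-- The image of the radical of `L` in `U(L)`, as a submodule for the adjoint action. -/
def ιRadical : LieSubmodule ℂ L (U L) :=
  LieSubmodule.map (ιHom L) (LieAlgebra.radical ℂ L)

lemma radAlg_eq_adjoin : radAlg L = Algebra.adjoin ℂ (ιRadical L : Set (U L)) := by
  rw [radAlg, ← Algebra.map_top, ← adjoin_range_ι, AlgHom.map_adjoin, ← Set.range_comp]
  congr 1
  ext a
  simp only [Set.mem_range, Function.comp_apply, uRadIncl, lift_ι_apply]
  exact ⟨fun ⟨y, hy⟩ => ⟨y, y.2, hy⟩, fun ⟨y, hy, h⟩ => ⟨⟨y, hy⟩, h⟩⟩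

variable {L}

lemma ι_mem_radAlg {y : L} (hy : y ∈ LieAlgebra.radical ℂ L) : ι ℂ y ∈ radAlg L := by
  rw [radAlg_eq_adjoin]
  exact Algebra.subset_adjoin ⟨y, hy, rfl⟩

variable (L) in
/-- The image of `U(r)` in `U(L)` as a submodule for the adjoint action. -/
def radLieSubmodule : LieSubmodule ℂ L (U L) :=
  { (radAlg L).toSubmodule with
    lie_mem := fun {x a} ha => by
      change a ∈ radAlg L at ha
      change ⁅x, a⁆ ∈ radAlg L
      rw [radAlg_eq_adjoin] at ha ⊢
      exact lie_mem_adjoin _ x ha }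

instance : LieRingModule L (radAlg L) := inferInstanceAs (LieRingModule L (radLieSubmodule L))

instance : LieModule ℂ L (radAlg L) := inferInstanceAs (LieModule ℂ L (radLieSubmodule L))

instance : IsLieEquivariant L (radAlg L) (radAlg L) where
  lie_smul_eq x a b := Subtype.ext (lie_mul x (a : U L) (b : U L))

variable (g : LieSubalgebra ℂ L)

lemma isLocallyFinite_restrict {W : Type v} [AddCommGroup W] [Module ℂ W] [LieRingModule L W]
    (h : IsLocallyFinite ℂ L W) : IsLocallyFinite ℂ g W := fun m =>
  let ⟨F, hF, hm⟩ := h m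
  ⟨F.restr g, hF, hm⟩

lemma isLocallyFinite_radAlg [FiniteDimensional ℂ L] : IsLocallyFinite ℂ g (radAlg L) :=
  isLocallyFinite_restrict g
    (isLocallyFinite_U.of_injective (radLieSubmodule L).incl Subtype.val_injective)

variable [IsLieAbelian (LieAlgebra.radical ℂ L)]

instance isMulCommutative_radAlg : IsMulCommutative (radAlg L) := by
  rw [radAlg_eq_adjoin]
  refine Algebra.isMulCommutative_adjoin ℂ ?_
  rintro _ ⟨x, hx, rfl⟩ _ ⟨y, hy, rfl⟩
  have h : ⁅x, y⁆ = 0 := congrArg Subtype.val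
    (trivial_lie_zero _ _ (⟨x, hx⟩ : LieAlgebra.radical ℂ L) (⟨y, hy⟩ : LieAlgebra.radical ℂ L))
  exact sub_eq_zero.mp (((ι ℂ).map_lie x y).symm.trans (by rw [h, map_zero]))

open scoped IsMulCommutative in
instance isNoetherianRing_radAlg [FiniteDimensional ℂ L] : IsNoetherianRing (radAlg L) := by
  have hfg : (radAlg L).FG := by
    obtain ⟨s, hs⟩ := (IsNoetherian.noetherian (LieAlgebra.radical ℂ L).toSubmodule).map
      (ιHom L : L →ₗ[ℂ] U L)
    exact ⟨s, by rw [← Algebra.adjoin_span, hs, radAlg_eq_adjoin]; rfl⟩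
  have hft : Algebra.FiniteType ℂ (radAlg L) := (Subalgebra.fg_iff_finiteType _).mp hfg
  exact Algebra.FiniteType.isNoetherianRing ℂ (radAlg L)

variable {g} (hLevi : IsCompl g.toSubmodule (LieAlgebra.radical ℂ L).toSubmodule)

include hLevi

omit [IsLieAbelian (LieAlgebra.radical ℂ L)] in
lemma exists_levi (x : L) : ∃ y ∈ g, ∃ z ∈ LieAlgebra.radical ℂ L, y + z = x :=
  Submodule.mem_sup.mp (hLevi.sup_eq_top ▸ Submodule.mem_top)

lemma mem_maxTrivSubmodule_iff_mem_radCenter {a : radAlg L} :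
    a ∈ maxTrivSubmodule ℂ g (radAlg L) ↔ (a : U L) ∈ radCenter L := by
  constructor
  · refine fun ha => ⟨Subalgebra.mem_center_iff.mpr fun b => ?_, a.2⟩
    induction b using universalEnvelopingAlgebra_induction with
    | ι x =>
      obtain ⟨y, hy, z, hz, rfl⟩ := exists_levi hLevi x
      have hya : ι ℂ y * (a : U L) = a * ι ℂ y :=
        sub_eq_zero.mp (congrArg Subtype.val (ha ⟨y, hy⟩))
      have hza : ι ℂ z * (a : U L) = a * ι ℂ z :=
        congrArg Subtype.val (mul_comm' ⟨ι ℂ z, ι_mem_radAlg hz⟩ a)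
      rw [map_add, add_mul, mul_add, hya, hza]
    | algebraMap t => exact Algebra.commutes t _
    | add b c hb hc => rw [add_mul, mul_add, hb, hc]
    | mul b c hb hc => rw [mul_assoc, hc, ← mul_assoc, hb, mul_assoc]
  · exact fun ha x => Subtype.ext
      (sub_eq_zero.mpr (Subalgebra.mem_center_iff.mp ha.1 (ι ℂ (x : L))))

end RadicalAlgebra

section SumOfProperSubmodules

lemma isCoatom_iff_eq_sSup_ne_top {α : Type*} [CompleteLattice α]
    (h : sSup {a : α | a ≠ ⊤} ≠ ⊤) {a : α} : IsCoatom a ↔ a = sSup {a | a ≠ ⊤} := by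
  constructor
  · exact fun ha => ((ha.le_iff.mp (le_sSup ha.1)).resolve_left h).symm
  · rintro rfl
    exact ⟨h, fun b hb => by_contra fun hb' => hb.not_ge (le_sSup hb')⟩

variable {K g X : Type*} [Field K] [LieRing g] [LieAlgebra K g]
  [AddCommGroup X] [Module K X] [LieRingModule g X] [LieModule K g X]
  [ComplementedLattice (LieSubmodule K g X)]

lemma le_lie_top_of_notMem {w₀ : X}
    (h : (maxTrivSubmodule K g X).toSubmodule ≤ Submodule.span K {w₀})
    {N : LieSubmodule K g X} (hN : w₀ ∉ N) :
    N ≤ ⁅(⊤ : LieIdeal K g), (⊤ : LieSubmodule K g X)⁆ := fun n hn => by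
  have : ComplementedLattice (LieSubmodule K g N) :=
    (submoduleOrderIsoIic N).complementedLattice_iff.mpr inferInstance
  obtain ⟨s, hs, t, ht, hst⟩ := exists_mem_maxTrivSubmodule_add_eq K g (⟨n, hn⟩ : N)
  obtain ⟨c, hc⟩ := Submodule.mem_span_singleton.mp
    (h (show (s : X) ∈ maxTrivSubmodule K g X from fun x => congrArg Subtype.val (hs x)))
  have hc0 : c = 0 := by
    by_contra hc0
    exact hN ((N.toSubmodule.smul_mem_iff hc0).mp (hc ▸ s.2))
  have hs0 : s = 0 := Subtype.ext (by rw [← hc, hc0, zero_smul]; rfl)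
  obtain rfl : t = ⟨n, hn⟩ := by rw [← hst, hs0, zero_add]
  exact map_mem_lie_top N.incl ht

end SumOfProperSubmodules

section RadicalAction

variable {L : Type u} [LieRing L] [LieAlgebra ℂ L]
  {W : Type v} [AddCommGroup W] [Module ℂ W] [LieRingModule L W] [LieModule ℂ L W]

/-- The action of the image of `U(r)` on an `L`-module. -/
abbrev radModule : Module (radAlg L) W :=
  Module.compHom W ((uAct L W).comp (radAlg L).val).toRingHom

attribute [local instance] radModule

lemma radAlg_smul_def (a : radAlg L) (m : W) : a • m = uAct L W (a : U L) m := rfl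

instance : IsScalarTower ℂ (radAlg L) W where
  smul_assoc t a m := by
    simp only [radAlg_smul_def, Subalgebra.coe_smul, map_smul, LinearMap.smul_apply]

instance : IsLieEquivariant L (radAlg L) W where
  lie_smul_eq x a m := by
    have h : ((⁅x, a⁆ : radAlg L) : U L) = ι ℂ x * a - a * ι ℂ x := rfl
    simp only [radAlg_smul_def, h, map_sub, map_mul, LinearMap.sub_apply, Module.End.mul_apply,
      uAct_ι, sub_add_cancel]

variable {g : LieSubalgebra ℂ L} {χ : RadCentralChar L}
  (hLevi : IsCompl g.toSubmodule (LieAlgebra.radical ℂ L).toSubmodule)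

include hLevi in
lemma HasRadCentralChar.exists_smul_eq [IsLieAbelian (LieAlgebra.radical ℂ L)]
    (h : HasRadCentralChar χ W) {a : radAlg L} (ha : a ∈ maxTrivSubmodule ℂ g (radAlg L)) :
    ∃ c : ℂ, ∀ m : W, a • m = c • m :=
  ⟨_, h ⟨a, (mem_maxTrivSubmodule_iff_mem_radCenter hLevi).mp ha⟩⟩

variable (g) in
/-- The vector `w₀` is `g`-invariant and generates the `L`-module `W`, which has radical central
character `χ`. Such modules are the quotients of `Q(0, χ)`. -/
structure IsSphericalVector (χ : RadCentralChar L) (w₀ : W) : Prop where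
  mem_maxTrivSubmodule : w₀ ∈ maxTrivSubmodule ℂ g W
  eq_top : ∀ N : LieSubmodule ℂ L W, w₀ ∈ N → N = ⊤
  hasRadCentralChar : HasRadCentralChar χ W

namespace IsSphericalVector

variable {w₀ : W} (hw : IsSphericalVector g χ w₀)

include hw hLevi

lemma orbitMap_surjective :
    Function.Surjective (orbitMap (A := radAlg L) ⟨w₀, hw.mem_maxTrivSubmodule⟩) := by
  set f := orbitMap (A := radAlg L) ⟨w₀, hw.mem_maxTrivSubmodule⟩
  let N : LieSubmodule ℂ L W :=
    { f.range.toSubmodule with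
      lie_mem := by
        rintro x _ ⟨a, rfl⟩
        obtain ⟨y, hy, z, hz, rfl⟩ := exists_levi hLevi x
        rw [add_lie]
        refine Submodule.add_mem _ ⟨⁅(⟨y, hy⟩ : g), a⁆, LieModuleHom.map_lie f _ _⟩
          ⟨⟨ι ℂ z, ι_mem_radAlg hz⟩ * a, ?_⟩
        change (⟨ι ℂ z, ι_mem_radAlg hz⟩ * a : radAlg L) • w₀ = ⁅z, a • w₀⁆
        rw [mul_smul, radAlg_smul_def, uAct_ι] }
  have hN : N = ⊤ := hw.eq_top N ⟨1, one_smul (radAlg L) w₀⟩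
  exact fun m => show m ∈ N from hN ▸ LieSubmodule.mem_top m

variable [FiniteDimensional ℂ L]

lemma isLocallyFinite : IsLocallyFinite ℂ g W :=
  (isLocallyFinite_radAlg g).of_surjective _ (hw.orbitMap_surjective hLevi)

variable [IsLieAbelian (LieAlgebra.radical ℂ L)]

lemma isNoetherian : IsNoetherian (radAlg L) W :=
  isNoetherian_of_surjective (LinearMap.toSpanSingleton (radAlg L) W w₀)
    (LinearMap.range_eq_top.mpr (hw.orbitMap_surjective hLevi))

variable [LieAlgebra.IsSemisimple ℂ g]

lemma maxTrivSubmodule_le_span_singleton :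
    (maxTrivSubmodule ℂ g W).toSubmodule ≤ Submodule.span ℂ {w₀} := by
  have := (isLocallyFinite_radAlg g).complementedLattice
  have := (hw.isLocallyFinite hLevi).complementedLattice
  refine maxTrivSubmodule_le_span (A := radAlg L)
    (fun _ => hw.hasRadCentralChar.exists_smul_eq hLevi)
    (Set.singleton_subset_iff.mpr hw.mem_maxTrivSubmodule) fun m _ => ?_
  exact Submodule.mem_span_singleton.mpr (hw.orbitMap_surjective hLevi m)

lemma sSup_ne_top (h0 : w₀ ≠ 0) : sSup {N : LieSubmodule ℂ L W | N ≠ ⊤} ≠ ⊤ := by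
  have := (hw.isLocallyFinite hLevi).complementedLattice
  let gW := ⁅(⊤ : LieIdeal ℂ g), (⊤ : LieSubmodule ℂ g W)⁆
  have hle : (sSup {N : LieSubmodule ℂ L W | N ≠ ⊤}).toSubmodule ≤ gW.toSubmodule := by
    rw [LieSubmodule.sSup_toSubmodule]
    refine sSup_le ?_
    rintro _ ⟨N, hN, rfl⟩
    exact le_lie_top_of_notMem (N := N.restr g) (hw.maxTrivSubmodule_le_span_singleton hLevi)
      fun hmem => hN (hw.eq_top N hmem)
  refine fun htop => h0 ?_
  rw [htop] at hle
  have hmem : w₀ ∈ maxTrivSubmodule ℂ g W ⊓ gW :=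
    ⟨hw.mem_maxTrivSubmodule, hle (LieSubmodule.mem_top w₀)⟩
  rw [isCompl_maxTrivSubmodule_lie_top.inf_eq_bot] at hmem
  exact (LieSubmodule.mem_bot w₀).mp hmem

lemma isIrreducible_quotient_iff (h0 : w₀ ≠ 0) (N : LieSubmodule ℂ L W) :
    IsIrreducible ℂ L (W ⧸ N) ↔ N = sSup {N | N ≠ ⊤} :=
  isIrreducible_quotient_iff_isCoatom.trans
    (isCoatom_iff_eq_sSup_ne_top (hw.sSup_ne_top hLevi h0))

theorem isHarishChandra : IsHarishChandra g W := by
  have hlf := hw.isLocallyFinite hLevi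
  have := hlf.complementedLattice
  have := hw.isNoetherian hLevi
  obtain ⟨S, hind, htop, hatom⟩ := exists_sSupIndep_of_sSup_atoms_eq_top
    (sSup_atoms_eq_top (α := LieSubmodule ℂ g W))
  refine ⟨S, fun N hN => ⟨isIrreducible_iff_isAtom.mpr (hatom hN),
    hlf.finiteDimensional_of_isAtom (hatom hN)⟩, hind, htop, fun N hN => ?_⟩
  have := hlf.finiteDimensional_of_isAtom (hatom hN)
  have : FiniteDimensional ℂ (N →ₗ⁅ℂ,g⁆ W) := finiteDimensional_lieModuleHom
    (isLocallyFinite_radAlg g) hlf fun _ => hw.hasRadCentralChar.exists_smul_eq hLevi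
  exact finite_setOf_equiv hind (hatom hN).1

end IsSphericalVector

end RadicalAction

section TrivialTypes

variable {K g W : Type*} [Field K] [LieRing g] [LieAlgebra K g]
  [AddCommGroup W] [Module K W] [LieRingModule g W] [LieModule K g W]

/-- The homomorphism from the trivial one-dimensional module sending `1` to the invariant `w`. -/
def trivHom (w : maxTrivSubmodule K g W) : TrivialLieModule K g K →ₗ⁅K,g⁆ W :=
  { LinearMap.toSpanSingleton K W (w : W) ∘ₗ (TrivialLieModule.equiv K g K).toLinearMap with
    map_lie' := fun {x c} => by
      have hw : ⁅x, (w : W)⁆ = 0 := w.2 x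
      change (0 : K) • (w : W) = ⁅x, (TrivialLieModule.equiv K g K) c • (w : W)⁆
      rw [lie_smul, hw, smul_zero, zero_smul] }

lemma trivHom_apply (w : maxTrivSubmodule K g W) (c : TrivialLieModule K g K) :
    trivHom w c = TrivialLieModule.equiv K g K c • (w : W) := rfl

end TrivialTypes

section Induction

variable {L : Type u} [LieRing L] [LieAlgebra ℂ L] {g : LieSubalgebra ℂ L}
  {M : Type v} [AddCommGroup M] [Module ℂ M] [LieRingModule g M] [LieModule ℂ g M]
  {W : Type w} [AddCommGroup W] [Module ℂ W] [LieRingModule L W] [LieModule ℂ L W]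

lemma uAct_ind (a : U L) (q : Ind g M) : uAct L (Ind g M) a q = a • q := by
  induction a using universalEnvelopingAlgebra_induction generalizing q with
  | ι x => exact uAct_ι x q
  | algebraMap t => rw [AlgHom.commutes, Module.algebraMap_end_apply, algebraMap_smul]
  | add a b ha hb => rw [map_add, LinearMap.add_apply, ha, hb, add_smul]
  | mul a b ha hb => rw [map_mul, Module.End.mul_apply, ha, hb, mul_smul]

lemma uIncl_ι (x : g) : uIncl g (ι ℂ x) = ι ℂ (x : L) := by
  rw [uIncl, lift_ι_apply]
  rfl

lemma uAct_uIncl (a : U g) (m : W) : uAct L W (uIncl g a) m = uAct g W a m := by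
  have h : (uAct L W).comp (uIncl g) = uAct g W := by
    ext x m
    change uAct L W (uIncl g (ι ℂ x)) m = uAct g W (ι ℂ x) m
    rw [uIncl_ι, uAct_ι, uAct_ι]
    rfl
  exact LinearMap.congr_fun (AlgHom.congr_fun h a) m

variable (g M) in
/-- The projection `U(L) ⊗_ℂ M → U(L) ⊗_{U(g)} M`. -/
def toInd : U L ⊗[ℂ] M →ₗ[U L] Ind g M := (indRel g M).mkQ

lemma toInd_surjective : Function.Surjective (toInd g M) := (indRel g M).mkQ_surjective

lemma toInd_uIncl_tmul (a : U g) (m : M) :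
    toInd g M (uIncl g a ⊗ₜ[ℂ] m) = toInd g M (1 ⊗ₜ[ℂ] uAct g M a m) :=
  (Submodule.Quotient.eq _).mpr (Submodule.subset_span ⟨1, a, m, by rw [one_mul]⟩)

lemma toInd_tmul (b : U L) (m : M) : toInd g M (b ⊗ₜ[ℂ] m) = b • toInd g M (1 ⊗ₜ[ℂ] m) := by
  rw [← map_smul, TensorProduct.smul_tmul', smul_eq_mul, mul_one]

variable (g M) in
/-- The canonical map `M → U(L) ⊗_{U(g)} M`, `m ↦ 1 ⊗ m`. -/
def indUnit : M →ₗ⁅ℂ,g⁆ Ind g M :=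
  { (toInd g M).restrictScalars ℂ ∘ₗ TensorProduct.mk ℂ (U L) M 1 with
    map_lie' := fun {x m} => by
      change toInd g M (1 ⊗ₜ[ℂ] ⁅x, m⁆) = ι ℂ (x : L) • toInd g M (1 ⊗ₜ[ℂ] m)
      rw [← toInd_tmul, ← uIncl_ι, toInd_uIncl_tmul, uAct_ι] }

lemma eq_top_of_forall_indUnit_mem {N : LieSubmodule ℂ L (Ind g M)} (h : ∀ m, indUnit g M m ∈ N) :
    N = ⊤ := by
  refine eq_top_iff.mpr fun q _ => ?_
  obtain ⟨t, rfl⟩ := toInd_surjective q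
  induction t using TensorProduct.induction_on with
  | zero => rw [map_zero]; exact N.zero_mem
  | add s t hs ht => rw [map_add]; exact N.add_mem (hs trivial) (ht trivial)
  | tmul b m =>
    rw [toInd_tmul, ← uAct_ind]
    exact uAct_mem N b (h m)

/-- The map `b ⊗ m ↦ b (f m)` underlying `indLift`. -/
def tensorLift (f : M →ₗ⁅ℂ,g⁆ W) : U L ⊗[ℂ] M →ₗ[ℂ] W :=
  TensorProduct.lift (LinearMap.lcomp ℂ W (f : M →ₗ[ℂ] W) ∘ₗ (uAct L W).toLinearMap)

omit [LieModule ℂ g M] in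
lemma tensorLift_tmul (f : M →ₗ⁅ℂ,g⁆ W) (b : U L) (m : M) :
    tensorLift f (b ⊗ₜ[ℂ] m) = uAct L W b (f m) := rfl

omit [LieModule ℂ g M] in
lemma tensorLift_smul (f : M →ₗ⁅ℂ,g⁆ W) (a : U L) (t : U L ⊗[ℂ] M) :
    tensorLift f (a • t) = uAct L W a (tensorLift f t) := by
  induction t using TensorProduct.induction_on with
  | zero => rw [smul_zero, map_zero, map_zero]
  | add s t hs ht => rw [smul_add, map_add, map_add, map_add, hs, ht]
  | tmul b m => rw [TensorProduct.smul_tmul', smul_eq_mul, tensorLift_tmul, tensorLift_tmul,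
      map_mul, Module.End.mul_apply]

lemma tensorLift_eq_zero (f : M →ₗ⁅ℂ,g⁆ W) {t : U L ⊗[ℂ] M} (ht : t ∈ indRel g M) :
    tensorLift f t = 0 := by
  induction ht using Submodule.span_induction with
  | mem t ht =>
    obtain ⟨b, a, m, rfl⟩ := ht
    rw [map_sub, tensorLift_tmul, tensorLift_tmul, map_mul, Module.End.mul_apply, uAct_uIncl,
      uAct_map, sub_self]
  | zero => exact map_zero _
  | add s t _ _ hs ht => rw [map_add, hs, ht, add_zero]
  | smul a t _ ht => rw [tensorLift_smul, ht, map_zero]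

/-- Frobenius reciprocity: the `L`-homomorphism `U(L) ⊗_{U(g)} M → W` extending the
`g`-homomorphism `f : M → W`. -/
def indLift (f : M →ₗ⁅ℂ,g⁆ W) : Ind g M →ₗ⁅ℂ,L⁆ W :=
  { (((indRel g M).restrictScalars ℂ).liftQ (tensorLift f) fun _ => tensorLift_eq_zero f) ∘ₗ
      (Submodule.Quotient.restrictScalarsEquiv ℂ (indRel g M)).symm.toLinearMap with
    map_lie' := fun {x q} => by
      obtain ⟨t, rfl⟩ := toInd_surjective q
      exact (tensorLift_smul f (ι ℂ x) t).trans (uAct_ι x _) }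

lemma indLift_indUnit (f : M →ₗ⁅ℂ,g⁆ W) (m : M) : indLift f (indUnit g M m) = f m := by
  change uAct L W 1 (f m) = f m
  rw [map_one, Module.End.one_apply]

end Induction

section UniversalModule

variable {L : Type u} [LieRing L] [LieAlgebra ℂ L] (g : LieSubalgebra ℂ L)
  {W : Type w} [AddCommGroup W] [Module ℂ W] [LieRingModule L W] [LieModule ℂ L W]

/-- The canonical generator `1 ⊗ 1` of `Q(0)`. -/
def q₀ : Q0 g := indUnit g (Triv g) ((TrivialLieModule.equiv ℂ g ℂ).symm 1)

lemma q₀_mem_maxTrivSubmodule : q₀ g ∈ maxTrivSubmodule ℂ g (Q0 g) := fun x => by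
  rw [q₀, ← LieModuleHom.map_lie, trivial_lie_zero, map_zero]

variable {g}

lemma eq_top_of_q₀_mem {N : LieSubmodule ℂ L (Q0 g)} (h : q₀ g ∈ N) : N = ⊤ := by
  refine eq_top_of_forall_indUnit_mem fun c => ?_
  have hc : c = TrivialLieModule.equiv ℂ g ℂ c • (TrivialLieModule.equiv ℂ g ℂ).symm 1 := by
    rw [← map_smul, smul_eq_mul, mul_one, LinearEquiv.symm_apply_apply]
  rw [hc, map_smul]
  exact N.smul_mem _ h

lemma exists_lieModuleHom_q₀ {w₀ : W} (hw : w₀ ∈ maxTrivSubmodule ℂ g W) :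
    ∃ φ : Q0 g →ₗ⁅ℂ,L⁆ W, φ (q₀ g) = w₀ := by
  refine ⟨indLift (trivHom ⟨w₀, hw⟩), ?_⟩
  rw [q₀, indLift_indUnit, trivHom_apply, LinearEquiv.apply_symm_apply, one_smul]

lemma map_mem_maxTrivSubmodule {X Y : Type*} [AddCommGroup X] [Module ℂ X] [LieRingModule L X]
    [LieModule ℂ L X] [AddCommGroup Y] [Module ℂ Y] [LieRingModule L Y] [LieModule ℂ L Y] {x₀ : X}
    (hx : x₀ ∈ maxTrivSubmodule ℂ g X) (f : X →ₗ⁅ℂ,L⁆ Y) : f x₀ ∈ maxTrivSubmodule ℂ g Y :=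
  fun x => by
    have h : ⁅(x : L), x₀⁆ = 0 := hx x
    exact (f.map_lie (x : L) x₀).symm.trans (by rw [h, map_zero])

omit [LieAlgebra ℂ L] in
lemma eq_top_of_map_mem {X Y : Type*} [AddCommGroup X] [Module ℂ X] [LieRingModule L X]
    [AddCommGroup Y] [Module ℂ Y] [LieRingModule L Y] {x₀ : X}
    (h : ∀ N : LieSubmodule ℂ L X, x₀ ∈ N → N = ⊤) {f : X →ₗ⁅ℂ,L⁆ Y}
    (hf : Function.Surjective f) {N : LieSubmodule ℂ L Y} (hN : f x₀ ∈ N) : N = ⊤ := by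
  have htop := h (N.comap f) hN
  refine eq_top_iff.mpr fun y _ => ?_
  obtain ⟨x, rfl⟩ := hf y
  exact show x ∈ N.comap f from htop ▸ LieSubmodule.mem_top x

lemma IsSphericalVector.map {X Y : Type*} [AddCommGroup X] [Module ℂ X] [LieRingModule L X]
    [LieModule ℂ L X] [AddCommGroup Y] [Module ℂ Y] [LieRingModule L Y] [LieModule ℂ L Y]
    {χ : RadCentralChar L} {x₀ : X} (hx : IsSphericalVector g χ x₀) (f : X →ₗ⁅ℂ,L⁆ Y)
    (hf : Function.Surjective f) : IsSphericalVector g χ (f x₀) where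
  mem_maxTrivSubmodule := map_mem_maxTrivSubmodule hx.mem_maxTrivSubmodule f
  eq_top _ := eq_top_of_map_mem hx.eq_top hf
  hasRadCentralChar := hx.hasRadCentralChar.of_surjective f hf

variable (g) in
lemma isSphericalVector_mk_q₀ (χ : RadCentralChar L) :
    IsSphericalVector g χ (LieSubmodule.Quotient.mk' (mQ g χ) (q₀ g)) where
  mem_maxTrivSubmodule := map_mem_maxTrivSubmodule (q₀_mem_maxTrivSubmodule g) _
  eq_top _ := eq_top_of_map_mem (fun _ => eq_top_of_q₀_mem)
    (LieSubmodule.Quotient.surjective_mk' _)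
  hasRadCentralChar z m := by
    obtain ⟨q, rfl⟩ := LieSubmodule.Quotient.surjective_mk' _ m
    rw [← uAct_map, ← map_smul, ← sub_eq_zero, ← map_sub, LieSubmodule.Quotient.mk_eq_zero]
    refine LieSubmodule.subset_lieSpan ⟨z - algebraMap ℂ _ (χ z), q, ?_, ?_⟩
    · rw [map_sub, AlgHom.commutes, Algebra.algebraMap_self_apply, sub_self]
    · change _ = uAct L (Q0 g) ((z : U L) - algebraMap ℂ (U L) (χ z)) q
      rw [map_sub, LinearMap.sub_apply, AlgHom.commutes, Module.algebraMap_end_apply]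

lemma lie_uAct_of_mem_radCenter {z : U L} (hz : z ∈ radCenter L) (x : L) (m : W) :
    ⁅x, uAct L W z m⁆ = uAct L W z ⁅x, m⁆ := by
  rw [← uAct_ι, ← uAct_ι, ← Module.End.mul_apply, ← Module.End.mul_apply, ← map_mul, ← map_mul,
    Subalgebra.mem_center_iff.mp hz.1]

lemma mQ_le_span (χ : RadCentralChar L) : (mQ g χ).toSubmodule ≤ Submodule.span ℂ
    {q | ∃ (z : radCenter L) (p : Q0 g), χ z = 0 ∧ q = uAct L (Q0 g) (z : U L) p} := by
  let N : LieSubmodule ℂ L (Q0 g) :=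
    { Submodule.span ℂ {q | ∃ (z : radCenter L) (p : Q0 g), χ z = 0 ∧ q = uAct L (Q0 g) z p} with
      lie_mem := fun {x q} hq => by
        induction hq using Submodule.span_induction with
        | mem q hq =>
          obtain ⟨z, p, hz, rfl⟩ := hq
          rw [lie_uAct_of_mem_radCenter z.2]
          exact Submodule.subset_span ⟨z, ⁅x, p⁆, hz, rfl⟩
        | zero => rw [lie_zero]; exact Submodule.zero_mem _
        | add p q _ _ hp hq => rw [lie_add]; exact Submodule.add_mem _ hp hq
        | smul t q _ hq => rw [lie_smul]; exact Submodule.smul_mem _ t hq }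
  exact show mQ g χ ≤ N from LieSubmodule.lieSpan_le.mpr Submodule.subset_span

end UniversalModule

section Nonvanishing

variable {L : Type u} [LieRing L] [LieAlgebra ℂ L] {g : LieSubalgebra ℂ L}
  (hLevi : IsCompl g.toSubmodule (LieAlgebra.radical ℂ L).toSubmodule)

/-- The projection of `L` onto the Levi subalgebra `g` along the radical, a Lie homomorphism
because the radical is an ideal. -/
def leviProj : L →ₗ⁅ℂ⁆ L :=
  { g.toSubmodule.projection _ hLevi with
    map_lie' := fun {x y} => by
      set p := g.toSubmodule.projection _ hLevi
      have hx : x - p x ∈ LieAlgebra.radical ℂ L := Submodule.sub_projection_mem hLevi x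
      have hy : y - p y ∈ LieAlgebra.radical ℂ L := Submodule.sub_projection_mem hLevi y
      have hg : ⁅p x, p y⁆ ∈ g := g.lie_mem (Submodule.projection_apply_mem hLevi x)
        (Submodule.projection_apply_mem hLevi y)
      have hr : ⁅x, y - p y⁆ + ⁅x - p x, p y⁆ ∈ LieAlgebra.radical ℂ L :=
        add_mem ((LieAlgebra.radical ℂ L).lie_mem hy) (lie_mem_left ℂ L _ _ _ hx)
      have h : ⁅x, y⁆ = ⁅p x, p y⁆ + (⁅x, y - p y⁆ + ⁅x - p x, p y⁆) := by
        rw [lie_sub, sub_lie]; abel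
      change p ⁅x, y⁆ = ⁅p x, p y⁆
      rw [h, map_add, (Submodule.projection_apply_eq_zero_iff hLevi).mpr hr, add_zero,
        Submodule.projection_apply_of_mem_left hLevi hg] }

lemma sub_leviProj_mem (x : L) : x - leviProj hLevi x ∈ LieAlgebra.radical ℂ L :=
  Submodule.sub_projection_mem hLevi x

lemma leviProj_of_mem {x : L} (hx : x ∈ g) : leviProj hLevi x = x :=
  Submodule.projection_apply_of_mem_left hLevi hx

lemma leviProj_eq_zero {x : L} (hx : x ∈ LieAlgebra.radical ℂ L) : leviProj hLevi x = 0 :=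
  (Submodule.projection_apply_eq_zero_iff hLevi).mpr hx

/-- The image of `U(r)` as a realisation of `Q(0)`: the Levi subalgebra acts by commutators and the
radical by left multiplication. The type is indexed by the Levi decomposition because the action
depends on it. -/
def RadModule (_ : IsCompl g.toSubmodule (LieAlgebra.radical ℂ L).toSubmodule) : Type u := radAlg L

namespace RadModule

instance : AddCommGroup (RadModule hLevi) := inferInstanceAs (AddCommGroup (radAlg L))

instance : Module ℂ (RadModule hLevi) := inferInstanceAs (Module ℂ (radAlg L))

/-- The identity map, with values in the realisation `RadModule hLevi` of `Q(0)`. -/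
def of : radAlg L ≃ₗ[ℂ] RadModule hLevi := LinearEquiv.refl ℂ (radAlg L)

instance : Bracket L (RadModule hLevi) where
  bracket x a := of hLevi (⁅leviProj hLevi x, (of hLevi).symm a⁆ +
    ⟨ι ℂ (x - leviProj hLevi x), ι_mem_radAlg (sub_leviProj_mem hLevi x)⟩ * (of hLevi).symm a)

lemma coe_lie (x : L) (a : RadModule hLevi) : (((of hLevi).symm ⁅x, a⁆ : radAlg L) : U L) =
    ι ℂ x * (of hLevi).symm a - (of hLevi).symm a * ι ℂ (leviProj hLevi x) := by
  change (ι ℂ (leviProj hLevi x) * ((of hLevi).symm a : U L) -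
    (of hLevi).symm a * ι ℂ (leviProj hLevi x)) +
    ι ℂ (x - leviProj hLevi x) * (of hLevi).symm a = _
  rw [map_sub]
  noncomm_ring

@[ext]
lemma ext {a b : RadModule hLevi}
    (h : (((of hLevi).symm a : radAlg L) : U L) = (of hLevi).symm b) : a = b :=
  (of hLevi).symm.injective (Subtype.ext h)

instance : LieRingModule L (RadModule hLevi) where
  add_lie x y a := by
    ext
    simp only [coe_lie, map_add, add_mul, mul_add, Subalgebra.coe_add]
    abel
  lie_add x a b := by
    ext
    simp only [coe_lie, map_add, add_mul, mul_add, Subalgebra.coe_add]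
    abel
  leibniz_lie x y a := by
    ext
    simp only [coe_lie, map_add, Subalgebra.coe_add, LieHom.map_lie,
      LieRing.of_associative_ring_bracket]
    noncomm_ring

instance : LieModule ℂ L (RadModule hLevi) where
  smul_lie t x a := by
    ext
    simp only [coe_lie, map_smul, Subalgebra.coe_smul, smul_mul_assoc, mul_smul_comm, smul_sub]
  lie_smul t x a := by
    ext
    simp only [coe_lie, map_smul, Subalgebra.coe_smul, smul_mul_assoc, mul_smul_comm, smul_sub]

lemma of_one_mem_maxTrivSubmodule : of hLevi 1 ∈ maxTrivSubmodule ℂ g (RadModule hLevi) :=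
  fun x => by
    change ⁅(x : L), of hLevi 1⁆ = 0
    ext
    rw [coe_lie, leviProj_of_mem hLevi x.2, LinearEquiv.symm_apply_apply, map_zero,
      OneMemClass.coe_one, mul_one, one_mul, sub_self]
    rfl

lemma coe_uAct {z : U L} (hz : z ∈ radAlg L) (a : RadModule hLevi) :
    (((of hLevi).symm (uAct L (RadModule hLevi) z a) : radAlg L) : U L) =
      z * (of hLevi).symm a := by
  rw [radAlg_eq_adjoin] at hz
  induction hz using Algebra.adjoin_induction generalizing a with
  | mem z hz =>
    obtain ⟨y, hy, rfl⟩ := hz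
    change (((of hLevi).symm (uAct L _ (ι ℂ y) a) : radAlg L) : U L) = ι ℂ y * (of hLevi).symm a
    rw [uAct_ι, coe_lie, leviProj_eq_zero hLevi hy, map_zero, mul_zero, sub_zero]
  | algebraMap t =>
    rw [AlgHom.commutes, Module.algebraMap_end_apply, map_smul, Subalgebra.coe_smul,
      Algebra.smul_def]
  | add y z _ _ hy hz =>
    rw [map_add, LinearMap.add_apply, map_add, Subalgebra.coe_add, hy, hz, add_mul]
  | mul y z _ _ hy hz => rw [map_mul, Module.End.mul_apply, hy, hz, mul_assoc]

end RadModule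

variable [FiniteDimensional ℂ L] [LieAlgebra.IsSemisimple ℂ g]
  [IsLieAbelian (LieAlgebra.radical ℂ L)]

/- Compose `χ` with the Reynolds projection onto the invariants. -/
include hLevi in
lemma exists_functional_radCenter_mul (χ : RadCentralChar L) : ∃ l : radAlg L →ₗ[ℂ] ℂ, l 1 = 1 ∧
    ∀ (z : radCenter L) (a : radAlg L), l (⟨z, z.2.2⟩ * a) = χ z * l a := by
  have := (isLocallyFinite_radAlg g).complementedLattice
  have mem_iff {a : radAlg L} : a ∈ maxTrivSubmodule ℂ g (radAlg L) ↔ (a : U L) ∈ radCenter L :=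
    mem_maxTrivSubmodule_iff_mem_radCenter hLevi
  let χ' : maxTrivSubmodule ℂ g (radAlg L) →ₗ[ℂ] ℂ :=
    { toFun s := χ ⟨s, mem_iff.mp s.2⟩
      map_add' s t := map_add χ ⟨s, mem_iff.mp s.2⟩ ⟨t, mem_iff.mp t.2⟩
      map_smul' c s := map_smul χ c ⟨s, mem_iff.mp s.2⟩ }
  have hcompl := LieSubmodule.isCompl_toSubmodule.mpr
    (isCompl_maxTrivSubmodule_lie_top (R := ℂ) (L := g) (M := radAlg L))
  let l := LinearMap.ofIsCompl hcompl χ' 0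
  have l_inv {s : radAlg L} (hs : s ∈ maxTrivSubmodule ℂ g (radAlg L)) :
      l s = χ ⟨s, mem_iff.mp hs⟩ := LinearMap.ofIsCompl_apply_left hcompl ⟨s, hs⟩
  have l_lie {t : radAlg L} (ht : t ∈ ⁅(⊤ : LieIdeal ℂ g), (⊤ : LieSubmodule ℂ g (radAlg L))⁆) :
      l t = 0 := LinearMap.ofIsCompl_apply_right hcompl ⟨t, ht⟩
  refine ⟨l, (l_inv (mem_iff.mpr (one_mem _))).trans (map_one χ), fun z a => ?_⟩
  obtain ⟨s, hs, t, ht, rfl⟩ := exists_mem_maxTrivSubmodule_add_eq ℂ g a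
  have hzs : l (⟨z, z.2.2⟩ * s) = χ z * l s := by
    rw [l_inv hs, ← map_mul]
    exact l_inv (mem_iff.mpr (mul_mem z.2 (mem_iff.mp hs)))
  have hzt : l (⟨z, z.2.2⟩ * t) = 0 := by
    let z' : maxTrivSubmodule ℂ g (radAlg L) := ⟨⟨z, z.2.2⟩, mem_iff.mpr z.2⟩
    refine (congrArg l (mul_comm' (z' : radAlg L) t)).trans (l_lie ?_)
    exact map_mem_lie_top (orbitMap (A := radAlg L) z') ht
  rw [mul_add, map_add, map_add, hzs, hzt, l_lie ht, add_zero, add_zero]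

include hLevi in
lemma q₀_notMem (χ : RadCentralChar L) : q₀ g ∉ mQ g χ := fun hmem => by
  obtain ⟨φ, hφ⟩ := exists_lieModuleHom_q₀ (RadModule.of_one_mem_maxTrivSubmodule hLevi)
  obtain ⟨l, hl1, hl⟩ := exists_functional_radCenter_mul hLevi χ
  let f : Q0 g →ₗ[ℂ] ℂ := l ∘ₗ (RadModule.of hLevi).symm.toLinearMap ∘ₗ (φ : Q0 g →ₗ[ℂ] _)
  have hle : (mQ g χ).toSubmodule ≤ f.ker := by
    refine (mQ_le_span χ).trans (Submodule.span_le.mpr ?_)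
    rintro _ ⟨z, p, hz, rfl⟩
    change l ((RadModule.of hLevi).symm (φ (uAct L (Q0 g) z p))) = 0
    rw [uAct_map, ← zero_mul (l ((RadModule.of hLevi).symm (φ p))), ← hz, ← hl]
    exact congrArg l (Subtype.ext (RadModule.coe_uAct hLevi z.2.2 (φ p)))
  have hf : f (q₀ g) = 0 := hle hmem
  refine one_ne_zero (α := ℂ) ?_
  rw [← hl1, ← hf]
  change _ = l ((RadModule.of hLevi).symm (φ (q₀ g)))
  rw [hφ, LinearEquiv.symm_apply_apply]

end Nonvanishing

section Isomorphisms

variable {R L X Y : Type*} [CommRing R] [LieRing L]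
  [AddCommGroup X] [Module R X] [LieRingModule L X]
  [AddCommGroup Y] [Module R Y] [LieRingModule L Y]

/-- The isomorphism of Lie modules underlying a bijective homomorphism. -/
def equivOfBijective (f : X →ₗ⁅R,L⁆ Y) (hf : Function.Bijective f) : X ≃ₗ⁅R,L⁆ Y :=
  { LinearEquiv.ofBijective (f : X →ₗ[R] Y) hf, f with }

variable [LieAlgebra R L] [LieModule R L X]

/-- The homomorphism on a quotient induced by a homomorphism that vanishes on the submodule. -/
def quotientLift (N : LieSubmodule R L X) (f : X →ₗ⁅R,L⁆ Y) (h : N ≤ f.ker) :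
    X ⧸ N →ₗ⁅R,L⁆ Y :=
  { N.toSubmodule.liftQ (f : X →ₗ[R] Y) h with
    map_lie' := fun {x m} => by
      obtain ⟨m, rfl⟩ := LieSubmodule.Quotient.surjective_mk' N m
      rw [← LieModuleHom.map_lie]
      exact f.map_lie x m }

/-- The first isomorphism theorem for a surjective homomorphism of Lie modules. -/
def quotKerEquivOfSurjective (f : X →ₗ⁅R,L⁆ Y) (hf : Function.Surjective f) :
    (X ⧸ f.ker) ≃ₗ⁅R,L⁆ Y :=
  equivOfBijective (quotientLift f.ker f le_rfl)
    ⟨LinearMap.ker_eq_bot.mp (Submodule.ker_liftQ_eq_bot _ _ _ le_rfl), fun y =>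
      (hf y).imp' (LieSubmodule.Quotient.mk' f.ker) fun _ h => h⟩

end Isomorphisms

section RadicalOnIrreducibles

variable {K L X : Type*} [Field K] [CharZero K] [LieRing L] [LieAlgebra K L] [FiniteDimensional K L]
  [AddCommGroup X] [Module K X] [LieRingModule L X] [LieModule K L X] [FiniteDimensional K X]
  [IsIrreducible K L X] [IsTriangularizable K L X]

lemma exists_lie_eq_smul_of_mem_radical {y : L} (hy : y ∈ LieAlgebra.radical K L) :
    ∃ c : K, ∀ m : X, ⁅y, m⁆ = c • m := by
  have := nontrivial_of_isIrreducible K L X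
  obtain ⟨μ, hμ⟩ := exists_nontrivial_weightSpace_of_isSolvable K (LieAlgebra.radical K L) X
  let N : LieSubmodule K L X := weightSpaceOfIsLieTower K X μ
  have hnt : Nontrivial N := hμ
  have hN : N = ⊤ := N.eq_top_of_isIrreducible K L X
  exact ⟨μ ⟨y, hy⟩, fun m =>
    (mem_weightSpace (μ : LieAlgebra.radical K L → K) m).mp
      (show m ∈ N from hN ▸ LieSubmodule.mem_top m) ⟨y, hy⟩⟩

lemma lie_lie_eq_zero_of_mem_radical (x : L) {y : L} (hy : y ∈ LieAlgebra.radical K L) (m : X) :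
    ⁅⁅x, y⁆, m⁆ = 0 := by
  obtain ⟨c, hc⟩ := exists_lie_eq_smul_of_mem_radical (X := X) hy
  rw [lie_lie, hc, hc, lie_smul, sub_self]

lemma lie_eq_zero_of_mem_radical {g : LieSubalgebra K L}
    (hgr : Submodule.span K {z : L | ∃ x ∈ g, ∃ y ∈ LieAlgebra.radical K L, ⁅x, y⁆ = z} =
      (LieAlgebra.radical K L).toSubmodule) {z : L} (hz : z ∈ LieAlgebra.radical K L) (m : X) :
    ⁅z, m⁆ = 0 := by
  have hle : (LieAlgebra.radical K L).toSubmodule ≤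
      ((toEnd K L X : L →ₗ[K] End K X).flip m).ker := by
    rw [← hgr, Submodule.span_le]
    rintro _ ⟨x, -, y, hy, rfl⟩
    exact lie_lie_eq_zero_of_mem_radical x hy m
  exact hle hz

end RadicalOnIrreducibles

section TrivialModule

variable {L : Type u} [LieRing L] [LieAlgebra ℂ L]
  {W : Type w} [AddCommGroup W] [Module ℂ W] [LieRingModule L W] [LieModule ℂ L W]

omit [LieAlgebra ℂ L] in
lemma isIrreducible_triv : IsIrreducible ℂ L (Triv L) := by
  have : Nontrivial (Triv L) := inferInstanceAs (Nontrivial ℂ)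
  have : IsSimpleModule ℂ (Triv L) := inferInstanceAs (IsSimpleModule ℂ ℂ)
  refine IsIrreducible.mk fun N hN => ?_
  rw [← LieSubmodule.toSubmodule_eq_top]
  exact (eq_bot_or_eq_top N.toSubmodule).resolve_left
    (by rwa [LieSubmodule.toSubmodule_eq_bot])

lemma trivHom_injective {w : maxTrivSubmodule ℂ L W} (hw : (w : W) ≠ 0) :
    Function.Injective (trivHom w) :=
  (smul_left_injective ℂ hw).comp (TrivialLieModule.equiv ℂ L ℂ).injective

lemma hasRadCentralChar_triv {χ : RadCentralChar L} (h : HasRadCentralChar χ W) {w : W}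
    (h0 : w ≠ 0) (hw : w ∈ maxTrivSubmodule ℂ L W) : HasRadCentralChar χ (Triv L) := fun z c => by
  refine trivHom_injective (w := ⟨w, hw⟩) h0 ?_
  rw [uAct_map, h, map_smul]

lemma hasType_triv_iff {g : LieSubalgebra ℂ L} :
    HasType g W (Triv g) ↔ ∃ w ∈ maxTrivSubmodule ℂ g W, w ≠ 0 := by
  constructor
  · rintro ⟨N, ⟨e⟩⟩
    let f : Triv g →ₗ⁅ℂ,g⁆ W := N.incl.comp e
    have hf : Function.Injective f := Subtype.val_injective.comp e.injective
    refine ⟨f ((TrivialLieModule.equiv ℂ g ℂ).symm 1), fun x => ?_, ?_⟩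
    · rw [← LieModuleHom.map_lie, trivial_lie_zero, map_zero]
    · exact (map_ne_zero_iff f hf).mpr ((LinearEquiv.map_ne_zero_iff _).mpr one_ne_zero)
  · rintro ⟨w, hw, h0⟩
    let f : Triv g →ₗ⁅ℂ,g⁆ W := trivHom ⟨w, hw⟩
    let f' : Triv g →ₗ⁅ℂ,g⁆ f.range := f.codRestrict f.range fun c => ⟨c, rfl⟩
    have hf' : Function.Bijective f' :=
      ⟨fun a b hab => trivHom_injective h0 (congrArg Subtype.val hab),
        fun ⟨_, c, hc⟩ => ⟨c, Subtype.ext hc⟩⟩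
    exact ⟨f.range, ⟨equivOfBijective f' hf'⟩⟩

end TrivialModule

section SimpleQuotient

variable {L : Type u} [LieRing L] [LieAlgebra ℂ L] {g : LieSubalgebra ℂ L}
  {W : Type w} [AddCommGroup W] [Module ℂ W] [LieRingModule L W] [LieModule ℂ L W]

lemma IsSphericalVector.ne_zero [Nontrivial W] {χ : RadCentralChar L} {w₀ : W}
    (hw : IsSphericalVector g χ w₀) : w₀ ≠ 0 := fun h =>
  bot_ne_top (hw.eq_top ⊥ ((LieSubmodule.mem_bot w₀).mpr h))

lemma mQ_le_ker {χ : RadCentralChar L} (hχ : HasRadCentralChar χ W) (φ : Q0 g →ₗ⁅ℂ,L⁆ W) :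
    mQ g χ ≤ φ.ker := by
  refine LieSubmodule.lieSpan_le.mpr ?_
  rintro _ ⟨z, p, hz, rfl⟩
  refine LieModuleHom.mem_ker.mpr ?_
  rw [uAct_map, hχ, hz, zero_smul]

lemma exists_surjective_of_hasType [IsIrreducible ℂ L W] {χ : RadCentralChar L}
    (hχ : HasRadCentralChar χ W) (ht : HasType g W (Triv g)) :
    ∃ f : Q g χ →ₗ⁅ℂ,L⁆ W, Function.Surjective f := by
  obtain ⟨w₀, hw, h0⟩ := hasType_triv_iff.mp ht
  obtain ⟨φ, rfl⟩ := exists_lieModuleHom_q₀ hw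
  let f := quotientLift (mQ g χ) φ (mQ_le_ker hχ φ)
  refine ⟨f, f.range_eq_top.mp ((eq_bot_or_eq_top f.range).resolve_left fun hbot => h0 ?_)⟩
  exact (LieSubmodule.mem_bot _).mp
    (hbot ▸ (f.mem_range _).mpr ⟨LieSubmodule.Quotient.mk' _ (q₀ g), rfl⟩)

variable (g) in
/-- The image of `1 ⊗ 1` in `V(0, χ)`. -/
def v₀ (χ : RadCentralChar L) : V g χ :=
  LieSubmodule.Quotient.mk' (maxSub g χ) (LieSubmodule.Quotient.mk' (mQ g χ) (q₀ g))

variable (χ : RadCentralChar L)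

variable (g) in
lemma isSphericalVector_v₀ : IsSphericalVector g χ (v₀ g χ) :=
  (isSphericalVector_mk_q₀ g χ).map _ (LieSubmodule.Quotient.surjective_mk' _)

variable [FiniteDimensional ℂ L] [LieAlgebra.IsSemisimple ℂ g]
  [IsLieAbelian (LieAlgebra.radical ℂ L)]
  (hLevi : IsCompl g.toSubmodule (LieAlgebra.radical ℂ L).toSubmodule)

include hLevi

lemma isIrreducible_quotient_iff_eq_maxSub (N : LieSubmodule ℂ L (Q g χ)) :
    IsIrreducible ℂ L (Q g χ ⧸ N) ↔ N = maxSub g χ :=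
  (isSphericalVector_mk_q₀ g χ).isIrreducible_quotient_iff hLevi
    (fun h => q₀_notMem hLevi χ ((LieSubmodule.Quotient.mk_eq_zero _).mp h)) N

lemma isIrreducible_V : IsIrreducible ℂ L (V g χ) :=
  (isIrreducible_quotient_iff_eq_maxSub χ hLevi (maxSub g χ)).mpr rfl

lemma hasType_V : HasType g (V g χ) (Triv g) := by
  have := isIrreducible_V χ hLevi
  have := nontrivial_of_isIrreducible ℂ L (V g χ)
  have hv := isSphericalVector_v₀ g χ
  exact hasType_triv_iff.mpr ⟨v₀ g χ, hv.mem_maxTrivSubmodule, hv.ne_zero⟩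

theorem nonempty_equiv_V [hW : IsIrreducible ℂ L W] (hχ : HasRadCentralChar χ W)
    (ht : HasType g W (Triv g)) : Nonempty (W ≃ₗ⁅ℂ,L⁆ V g χ) := by
  obtain ⟨f, hf⟩ := exists_surjective_of_hasType hχ ht
  let e := quotKerEquivOfSurjective f hf
  have hker : f.ker = maxSub g χ := (isIrreducible_quotient_iff_eq_maxSub χ hLevi f.ker).mp
    ((LieSubmodule.orderIsoMapComap e).isSimpleOrder_iff.mpr hW)
  have he : Nonempty (W ≃ₗ⁅ℂ,L⁆ Q g χ ⧸ f.ker) := ⟨e.symm⟩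
  rwa [hker] at he

lemma nonempty_equiv_triv_iff :
    Nonempty (V g χ ≃ₗ⁅ℂ,L⁆ Triv L) ↔ HasRadCentralChar χ (Triv L) := by
  constructor
  · rintro ⟨e⟩
    exact (isSphericalVector_v₀ g χ).hasRadCentralChar.of_surjective
      (e : V g χ →ₗ⁅ℂ,L⁆ Triv L) e.surjective
  · intro h
    have := isIrreducible_triv (L := L)
    have ht : HasType g (Triv L) (Triv g) := hasType_triv_iff.mpr
      ⟨(TrivialLieModule.equiv ℂ L ℂ).symm 1, fun _ => rfl,
        (LinearEquiv.map_ne_zero_iff _).mpr one_ne_zero⟩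
    exact (nonempty_equiv_V χ hLevi h ht).map LieModuleEquiv.symm

lemma nonempty_equiv_triv_of_finiteDimensional
    (hgr : Submodule.span ℂ {z : L | ∃ x ∈ g, ∃ y ∈ LieAlgebra.radical ℂ L, ⁅x, y⁆ = z} =
      (LieAlgebra.radical ℂ L).toSubmodule) [FiniteDimensional ℂ (V g χ)] :
    Nonempty (V g χ ≃ₗ⁅ℂ,L⁆ Triv L) := by
  have := isIrreducible_V χ hLevi
  have := nontrivial_of_isIrreducible ℂ L (V g χ)
  have hv := isSphericalVector_v₀ g χ
  have hinv : v₀ g χ ∈ maxTrivSubmodule ℂ L (V g χ) := fun x => by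
    obtain ⟨y, hy, z, hz, rfl⟩ := exists_levi hLevi x
    rw [add_lie, lie_eq_zero_of_mem_radical hgr hz, add_zero]
    exact hv.mem_maxTrivSubmodule ⟨y, hy⟩
  exact (nonempty_equiv_triv_iff χ hLevi).mpr
    (hasRadCentralChar_triv hv.hasRadCentralChar hv.ne_zero hinv)

end SimpleQuotient

end GenTakiff

end

theorem proposition6p5_general {L : Type*} [LieRing L] [LieAlgebra ℂ L] [FiniteDimensional ℂ L]
    (g : LieSubalgebra ℂ L) [LieAlgebra.IsSemisimple ℂ g]
    (hLevi : IsCompl g.toSubmodule (LieAlgebra.radical ℂ L).toSubmodule)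
    (hab : IsLieAbelian (LieAlgebra.radical ℂ L))
    (χ : RadCentralChar L) :
    (∀ N : LieSubmodule ℂ L (Q g χ), LieModule.IsIrreducible ℂ L (Q g χ ⧸ N) ↔ N = maxSub g χ) ∧
    (LieModule.IsIrreducible ℂ L (V g χ) ∧ HasRadCentralChar χ (V g χ) ∧
      HasType g (V g χ) (Triv g)) ∧
    (∀ (W : Type*) [AddCommGroup W] [Module ℂ W] [LieRingModule L W] [LieModule ℂ L W],
      LieModule.IsIrreducible ℂ L W → HasRadCentralChar χ W → HasType g W (Triv g) →
        Nonempty (W ≃ₗ⁅ℂ, L⁆ V g χ)) ∧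
    (Submodule.span ℂ {z : L | ∃ x ∈ g, ∃ y ∈ LieAlgebra.radical ℂ L, ⁅x, y⁆ = z} =
        (LieAlgebra.radical ℂ L).toSubmodule →
      Nonempty (V g χ ≃ₗ⁅ℂ, L⁆ Triv L) ∨ ¬ FiniteDimensional ℂ (V g χ)) ∧
    (Nonempty (V g χ ≃ₗ⁅ℂ, L⁆ Triv L) ↔ HasRadCentralChar χ (Triv L)) ∧
    IsHarishChandra g (V g χ) := by
  have hv := isSphericalVector_v₀ g χ
  refine ⟨isIrreducible_quotient_iff_eq_maxSub χ hLevi,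
    ⟨isIrreducible_V χ hLevi, hv.hasRadCentralChar, hasType_V χ hLevi⟩,
    fun W _ _ _ _ _ hχ ht => nonempty_equiv_V χ hLevi hχ ht,
    fun hgr => or_iff_not_imp_right.mpr fun hfin => ?_,
    nonempty_equiv_triv_iff χ hLevi, hv.isHarishChandra hLevi⟩
  have := not_not.mp hfin
  exact nonempty_equiv_triv_of_finiteDimensional χ hLevi hgr

theorem proposition6p5 {L : Type*} [LieRing L] [LieAlgebra ℂ L] [FiniteDimensional ℂ L]
    (g : LieSubalgebra ℂ L) [LieAlgebra.IsSemisimple ℂ g]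
    (hLevi : IsCompl g.toSubmodule (LieAlgebra.radical ℂ L).toSubmodule)
    (hab : IsLieAbelian (LieAlgebra.radical ℂ L))
    (χ : RadCentralChar L) :
    -- `V(0, χ)` is the unique simple quotient of `Q(0, χ)`
    (∀ N : LieSubmodule ℂ L (Q g χ), LieModule.IsIrreducible ℂ L (Q g χ ⧸ N) ↔ N = maxSub g χ) ∧
    -- `V(0, χ)` is simple, has character `χ`, and has the trivial `g`-module as a `g`-type
    (LieModule.IsIrreducible ℂ L (V g χ) ∧ HasRadCentralChar χ (V g χ) ∧
      HasType g (V g χ) (Triv g)) ∧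
    -- and every such module is isomorphic to it
    (∀ (W : Type*) [AddCommGroup W] [Module ℂ W] [LieRingModule L W] [LieModule ℂ L W],
      LieModule.IsIrreducible ℂ L W → HasRadCentralChar χ W → HasType g W (Triv g) →
        Nonempty (W ≃ₗ⁅ℂ, L⁆ V g χ)) ∧
    -- if `[g, r] = r`, then `V(0, χ)` is trivial or infinite-dimensional
    (Submodule.span ℂ {z : L | ∃ x ∈ g, ∃ y ∈ LieAlgebra.radical ℂ L, ⁅x, y⁆ = z} =
        (LieAlgebra.radical ℂ L).toSubmodule →
      (Nonempty (V g χ ≃ₗ⁅ℂ, L⁆ Triv L) ∨ ¬ FiniteDimensional ℂ (V g χ)) ∧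
      (Nonempty (V g χ ≃ₗ⁅ℂ, L⁆ Triv L) ↔ HasRadCentralChar χ (Triv L))) ∧
    -- `V(0, χ)` is a `g`-Harish-Chandra module
    IsHarishChandra g (V g χ) := by
  obtain ⟨hquot, hV, huniq, hdich, htriv, hHC⟩ := proposition6p5_general g hLevi hab χ
  exact ⟨hquot, hV, huniq, fun hgr => ⟨hdich hgr, htriv⟩, hHC⟩
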